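/- **Setting.** Let $G=(V,E)$ be an undirected, unweighted simple graph with $n$ vertices, neighbourhoods $N[u]$, degrees $d_u$, adjacency matrix $\mathbf A$ and degree matrix $\mathbf D$. A query consists of $a,b\in[0,1]$ with $a+b\ge 1$, weights $w_i\ge 0$ with $\sum_{i\ge 0}w_i=1$, and a vector $\mathbf x\ge 0$ with $\|\mathbf x\|_1=1$. Put $Y_i=\sum_{k\ge i}w_k$. An oracle returns in one step $w_i$, for any $i$, and $L_w(\Delta)=\min\{k: Y_k\le\Delta\}$, for any $\Delta>0$. For $\delta,c>0$ put $L=L_w(c\delta)$ and $\varepsilon=\frac{c^2\delta}{2(L+1)}$. **Algorithm (AGP-Static++).** For each $u$ the sorted list $B[u]$ of the non-empty buckets $B[u]_j=\{v\in N[u]: 2^j\le d_v<2^{j+1}\}$ is available before the query. The query starts with an initialization, which computes $L$ and $\varepsilon$ and produces the initial vector $\hat{\mathbf r}^{(0)}$ with the list of its non-zero entries; either $\hat{\mathbf r}^{(0)}=\mathbf x$, read entry by entry, or $\hat{\mathbf r}^{(0)}$ is any non-negative random vector with $\mathrm E[\hat{\mathbf r}^{(0)}]=\mathbf x$ (producing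 it takes at least one step per non-zero entry). For $i=0,\dots,L-1$ and each $u$ with $\hat{\mathbf r}^{(i)}(u)\ne0$, a subset $T\subseteq N[u]$ is sampled that contains each $v\in N[u]$ independently with probability $p_{u,v}=\min\{1,s/d_v^a\}$, $s=\frac1\varepsilon\frac{Y_{i+1}}{Y_i}\frac{\hat{\mathbf r}^{(i)}(u)}{d_u^b}$; each $v\in T$ receives $\max\{\varepsilon,\frac{Y_{i+1}}{Y_i}\frac{\hat{\mathbf r}^{(i)}(u)}{d_v^ad_u^b}\}$ in $\hat{\mathbf r}^{(i+1)}$, and $\frac{w_i}{Y_i}\hat{\mathbf r}^{(i)}(u)$ is added to the output $\hat{\boldsymbol\pi}(u)$. Finally $\frac{w_L}{Y_L}\hat{\mathbf r}^{(L)}$ is added to $\hat{\boldsymbol\pi}$. (When the current vector has become zero the loop is left.) The sampling treats each bucket $B[u]_j$ with $p^*=\min\{1,s/(2^j)^a\}$: if $p^*=1$ all its elements are candidates, otherwise candidates are found by jumps distributed as the index of the first success in independent trials of probability $p^*$ (bounded geometric variates); each candidate $v$ is accepted with probability $p_{u,v}/p^*$. Running time is the number of instructions on a real RAM: arithmetic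 operations, comparisons, powers, logarithms and rounding of reals, array and list accesses, oracle calls, and drawing a uniform random real from $[0,1]$ cost one step each. A bounded geometric variate is generated from one uniform real by inversion. **Initialization cost.** $C_{\mathrm{init}}$ is the number of steps of the initialization plus, if $L\ge1$, the number $\sum_{u:\hat{\mathbf r}^{(0)}(u)\ne0}|B[u]|$ of buckets that have to be opened at the non-zero entries of the initial vector. **Statement.** 1. There is an absolute constant $K$ such that for all $n\ge2$, $G$, $u\in V$, $a\in[0,1]$ and $s\ge0$ the sampling procedure at $u$ with factor $s$ returns a set of expected size $\mu=\sum_{v\in N[u]}\min\{1,s/d_v^a\}$ in expected time at most $K(\mu+\log n)$. 2. For every $c>0$ there is a constant $K$, depending only on $c$, such that for every $n$, every graph $G$ on $n$ vertices, every query, every $\delta>0$ and every initialization as above, the expected query time of AGP-Static++ is at most $$K\left(\log n\cdot\frac{L}{\delta}\sum_{i=1}^{L}\bigl\|Y_i(\mathbf D^{-a}\mathbf A\mathbf D^{-b})^i\mathbf x\bigr\|_1+\mathrm E[C_{\mathrm{init}}]\right).$$ 3. Setting $\hat{\mathbf r}^{(0)}=\mathbf x$ by reading $\mathbf x$ is such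 an initialization, and for it $\mathrm E[C_{\mathrm{init}}]\le K\bigl(n+\sum_{u:\mathbf x(u)\ne0}|B[u]|\bigr)$ with an absolute constant $K$. -/

import Mathlib

open scoped ENNReal NNReal

namespace AGP

/-! ## Randomized programs with a step count (real RAM with uniform random reals) -/

/-- A randomized terminating computation: the joint law of its result and of the number of
machine instructions it executes. -/
structure Comp (α : Type) where
  /-- The joint law of (result, number of executed instructions). -/
  law : PMF (α × ℕ)

noncomputable instance : Monad Comp where
  pure a := ⟨PMF.pure (a, 0)⟩
  bind m f := ⟨m.law.bind fun z => (f z.1).law.map fun y => (y.1, z.2 + y.2)⟩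

/-- One machine instruction with result `y`. In the programs below each `step` holds exactly one
instruction: a real or integer arithmetic operation, power, logarithm or comparison, a read or a
write of one array cell, pushing to or reading the next cell of a list, or one oracle call. -/
noncomputable def step {α : Type} (y : α) : Comp α := ⟨PMF.pure (y, 1)⟩

/-- Draw one fresh `U` uniformly from `[0,1]` and evaluate a fixed integer-valued straight-line
expression `g U`; `k` is the number of instructions, the one that draws `U` included. -/
noncomputable def draw (k : ℕ) (g : unitInterval → ℕ) (hg : Measurable g) : Comp ℕ :=
  haveI : MeasureTheory.IsProbabilityMeasure
      ((MeasureTheory.volume : MeasureTheory.Measure unitInterval).map g) :=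
    MeasureTheory.Measure.isProbabilityMeasure_map hg.aemeasurable
  ⟨((MeasureTheory.volume : MeasureTheory.Measure unitInterval).map g).toPMF.map fun y => (y, k)⟩

/-- The expectation of a function of the result and the number of executed instructions. -/
noncomputable def Comp.expect {α : Type} (m : Comp α) (f : α → ℕ → ℝ≥0∞) : ℝ≥0∞ :=
  ∑' z : α × ℕ, m.law z * f z.1 z.2

/-- The expected running time. -/
noncomputable def Comp.expectedTime {α : Type} (m : Comp α) : ℝ≥0∞ :=
  m.expect fun _ t => (t : ℝ≥0∞)

/-! ## Queries and the propagation matrix -/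

/-- A query `q(a, b, O_w, x)` on a graph with vertex set `Fin n`. -/
structure Query (n : ℕ) where
  /-- The exponent of the left degree matrix. -/
  a : ℝ
  /-- The exponent of the right degree matrix. -/
  b : ℝ
  /-- The weights. -/
  w : ℕ → ℝ
  /-- The input vector. -/
  x : Fin n → ℝ
  a_nonneg : 0 ≤ a
  a_le_one : a ≤ 1
  b_nonneg : 0 ≤ b
  b_le_one : b ≤ 1
  one_le_add : 1 ≤ a + b
  w_nonneg : ∀ i, 0 ≤ w i
  w_hasSum : HasSum w 1
  x_nonneg : ∀ v, 0 ≤ x v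
  x_sum : ∑ v, x v = 1

/-- `Y_i = ∑_{k ≥ i} w_k`. -/
noncomputable def Query.Y {n : ℕ} (q : Query n) (i : ℕ) : ℝ := ∑' k : ℕ, q.w (i + k)

/-- The oracle's second answer: the smallest `k` with `∑_{i ≥ k} w_i ≤ Δ`. -/
noncomputable def Query.oracleL {n : ℕ} (q : Query n) (Δ : ℝ) : ℕ := sInf {k : ℕ | q.Y k ≤ Δ}

/-- `D^{-a} A D^{-b}`. -/
noncomputable def propMatrix {n : ℕ} (G : SimpleGraph (Fin n)) [DecidableRel G.Adj] (a b : ℝ) :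
    Matrix (Fin n) (Fin n) ℝ :=
  Matrix.diagonal (fun v => (G.degree v : ℝ) ^ (-a)) * G.adjMatrix ℝ *
    Matrix.diagonal (fun v => (G.degree v : ℝ) ^ (-b))

/-- The `ℓ¹` norm. -/
def l1 {n : ℕ} (z : Fin n → ℝ) : ℝ := ∑ v, |z v|

/-! ## The subset sampling structure and the subset sampling procedure

Arrays are represented by functions or by lists that are read by index in one instruction. -/

/-- The array of the neighbours `v` of `u` with `2 ^ j ≤ d_v < 2 ^ (j + 1)`. -/
def bucket {n : ℕ} (G : SimpleGraph (Fin n)) [DecidableRel G.Adj] (u : Fin n) (j : ℕ) :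
    List (Fin n) :=
  (List.finRange n).filter fun v => G.Adj u v ∧ 2 ^ j ≤ G.degree v ∧ G.degree v < 2 ^ (j + 1)

/-- `B[u]`: the sorted list of the non-empty buckets of `u`, each with its index. It is built
before any query arrives. -/
def buckets {n : ℕ} (G : SimpleGraph (Fin n)) [DecidableRel G.Adj] (u : Fin n) :
    List (ℕ × List (Fin n)) :=
  ((List.range (Nat.log 2 n + 1)).map fun j => (j, bucket G u j)).filter fun B => B.2 ≠ []

/-- A coin that shows `true` with probability `p`, for `p ∈ [0,1]`
(draw `U`, one addition, one rounding). -/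
noncomputable def coin (p : ℝ) : Comp Bool := do
  let k ← draw 3 (fun U => ⌊(U : ℝ) + p⌋₊) (by fun_prop)
  step (decide (1 ≤ k))

/-- The bounded geometric variate `Geo(p, N)` for `0 ≤ p < 1`: the index of the first success among
`N` independent trials of success probability `p`, and `N + 1` if all of them fail. It is generated
by inversion (draw `U`, then subtraction, logarithm, division, rounding, addition). -/
noncomputable def boundedGeo (p : ℝ) (N : ℕ) : Comp ℕ := do
  let M ← step (N + 1)
  if (← step (decide (0 < p))) then
    let q ← step (1 - p)
    let l ← step (Real.log q)
    let g ← draw 6 (fun U => ⌊Real.log (1 - (U : ℝ)) / l⌋₊ + 1) (by fun_prop)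
    step (min g M)
  else
    return M

/-- The loop that samples each element of the array `B` with probability `p`, by jumps with the law
`Geo(p, |B|)` from the current position `y`. Jumps are at least one, so that `|B| + 1` units of
fuel are never exhausted. -/
noncomputable def jumpLoop {n : ℕ} (p : ℝ) (B : List (Fin n)) :
    (fuel : ℕ) → (y : ℕ) → (cand : List (Fin n)) → Comp (List (Fin n))
  | 0, _, cand => return cand
  | fuel + 1, y, cand => do
    let N ← step B.length
    let j ← boundedGeo p N
    let y ← step (y + j)
    if (← step (decide (N < y))) then
      return cand
    else
      match B[y - 1]? with
      | none => return cand
      | some v =>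
        let v ← step v
        let cand ← step (v :: cand)
        jumpLoop p B fuel y cand

/-- Accept each candidate `v` with probability `p_{u,v} / p`, where
`p_{u,v} = min {1, s / d_v ^ a}`, and push the accepted ones to `T`. -/
noncomputable def acceptLoop {n : ℕ} (G : SimpleGraph (Fin n)) [DecidableRel G.Adj] (a s p : ℝ) :
    (cand T : List (Fin n)) → Comp (List (Fin n))
  | [], T => step T
  | v :: cand, T => do
    let v ← step v
    let d ← step (G.degree v : ℝ)
    let da ← step (d ^ a)
    let t ← step (s / da)
    let puv ← step (min 1 t)
    let pac ← step (puv / p)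
    if (← coin pac) then
      let T ← step (v :: T)
      acceptLoop G a s p cand T
    else
      acceptLoop G a s p cand T

/-- The sampling inside one bucket with shifting factor `s`: all elements are candidates if
`p* = min {1, s / (2 ^ j) ^ a}` is `1`, otherwise each is a candidate with probability `p*`. -/
noncomputable def sampleBucket {n : ℕ} (G : SimpleGraph (Fin n)) [DecidableRel G.Adj] (a s : ℝ)
    (B : ℕ × List (Fin n)) (T : List (Fin n)) : Comp (List (Fin n)) := do
  let e ← step ((2 : ℝ) ^ B.1)
  let ea ← step (e ^ a)
  let t ← step (s / ea)
  let p ← step (min 1 t)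
  if (← step (decide (p < 1))) then
    let cand ← jumpLoop p B.2 (B.2.length + 1) 0 []
    acceptLoop G a s p cand T
  else
    acceptLoop G a s p B.2 T

/-- The sampling in all buckets of a list, one after the other. -/
noncomputable def bucketLoop {n : ℕ} (G : SimpleGraph (Fin n)) [DecidableRel G.Adj] (a s : ℝ) :
    (Bs : List (ℕ × List (Fin n))) → (T : List (Fin n)) → Comp (List (Fin n))
  | [], T => step T
  | B :: Bs, T => do
    let B ← step B
    let T ← sampleBucket G a s B T
    bucketLoop G a s Bs T

/-- The subset `T` sampled from `N[u]`, for the shifting factor `s`. -/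
noncomputable def sampleNeighbours {n : ℕ} (G : SimpleGraph (Fin n)) [DecidableRel G.Adj]
    (a s : ℝ) (u : Fin n) : Comp (List (Fin n)) :=
  bucketLoop G a s (buckets G u) []

/-- `p_{u,v} = min {1, s / d_v ^ a}` for the shifting factor `s` of `u`. -/
noncomputable def prob {n : ℕ} (G : SimpleGraph (Fin n)) [DecidableRel G.Adj] (a s : ℝ)
    (v : Fin n) : ℝ :=
  min 1 (s / (G.degree v : ℝ) ^ a)

/-- The expected sample size `μ_u = ∑_{v ∈ N[u]} p_{u,v}`. -/
noncomputable def meanSize {n : ℕ} (G : SimpleGraph (Fin n)) [DecidableRel G.Adj] (a s : ℝ)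
    (u : Fin n) : ℝ :=
  ∑ v ∈ G.neighborFinset u, prob G a s v

/-! ## The query algorithm -/

/-- A residue vector in memory: an array together with the list of its non-zero positions. -/
structure SparseVec (n : ℕ) where
  /-- The array. -/
  val : Fin n → ℝ
  /-- The list of the non-zero positions. -/
  supp : List (Fin n)

/-- `r(v) ← r(v) + t`. -/
noncomputable def SparseVec.addTo {n : ℕ} (r : SparseVec n) (v : Fin n) (t : ℝ) :
    Comp (SparseVec n) := do
  let old ← step (r.val v)
  let new ← step (old + t)
  let val ← step (Function.update r.val v new)
  if (← step (decide (old = 0))) then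
    let supp ← step (v :: r.supp)
    return ⟨val, supp⟩
  else
    return ⟨val, r.supp⟩

/-- Propagate `max {ε, m / d_v ^ a}` to every `v ∈ T`, where
`m = (Y_{i+1} / Y_i) * r(u) / d_u ^ b`. -/
noncomputable def propagate {n : ℕ} (G : SimpleGraph (Fin n)) [DecidableRel G.Adj] (a ε m : ℝ) :
    (T : List (Fin n)) → (next : SparseVec n) → Comp (SparseVec n)
  | [], next => step next
  | v :: T, next => do
    let v ← step v
    let d ← step (G.degree v : ℝ)
    let da ← step (d ^ a)
    let t ← step (m / da)
    let t ← step (max ε t)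
    let next ← next.addTo v t
    propagate G a ε m T next

/-- The memory during one iteration: the current residue array (whose entries are reset to zero as
soon as they have been processed), the next residue, and the output array. -/
structure Memory (n : ℕ) where
  /-- The current residue array. -/
  cur : Fin n → ℝ
  /-- The next residue vector. -/
  next : SparseVec n
  /-- The output array. -/
  out : Fin n → ℝ

/-- The body of the inner loop, for one vertex `u`, with `κ = Y_{i+1} / Y_i` and
`σ = w_i / Y_i`. (If `u` is isolated then the value of `s` is not used by the sampling.) -/
noncomputable def visit {n : ℕ} (G : SimpleGraph (Fin n)) [DecidableRel G.Adj]
    (a b ε κ σ : ℝ) (u : Fin n) (mem : Memory n) : Comp (Memory n) := do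
  let r ← step (mem.cur u)
  let cur ← step (Function.update mem.cur u 0)
  let d ← step (G.degree u : ℝ)
  let db ← step (d ^ b)
  let t ← step (κ * r)
  let m ← step (t / db)
  let s ← step (m / ε)
  let T ← sampleNeighbours G a s u
  let next ← propagate G a ε m T mem.next
  let z ← step (σ * r)
  let old ← step (mem.out u)
  let new ← step (old + z)
  let out ← step (Function.update mem.out u new)
  return ⟨cur, next, out⟩

/-- The inner loop over the vertices with non-zero residue. -/
noncomputable def visitLoop {n : ℕ} (G : SimpleGraph (Fin n)) [DecidableRel G.Adj]
    (a b ε κ σ : ℝ) : (us : List (Fin n)) → (mem : Memory n) → Comp (Memory n)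
  | [], mem => step mem
  | u :: us, mem => do
    let u ← step u
    let mem ← visit G a b ε κ σ u mem
    visitLoop G a b ε κ σ us mem

/-- `out ← out + σ * r` over the listed positions (the last reserve vector). -/
noncomputable def addReserve {n : ℕ} (σ : ℝ) (r : Fin n → ℝ) :
    (us : List (Fin n)) → (out : Fin n → ℝ) → Comp (Fin n → ℝ)
  | [], out => step out
  | u :: us, out => do
    let u ← step u
    let ru ← step (r u)
    let z ← step (σ * ru)
    let old ← step (out u)
    let new ← step (old + z)
    let out ← step (Function.update out u new)
    addReserve σ r us out

/-- The outer loop from iteration `i` on, with `k = L - i` iterations left, `Y = Y_i`, the residue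
`r`, an all-zero array `blank` and the output array `out`. When no vertex has non-zero residue, the
remaining iterations change nothing, and the loop is left. -/
noncomputable def mainLoop {n : ℕ} (G : SimpleGraph (Fin n)) [DecidableRel G.Adj] (q : Query n)
    (ε : ℝ) : (k i : ℕ) → (Y : ℝ) → (r : SparseVec n) → (blank out : Fin n → ℝ) →
    Comp (Fin n → ℝ)
  | 0, i, Y, r, _, out => do
    if (← step r.supp.isEmpty) then
      return out
    else
      let wi ← step (q.w i)
      let σ ← step (wi / Y)
      addReserve σ r.val r.supp out
  | k + 1, i, Y, r, blank, out => do
    if (← step r.supp.isEmpty) then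
      return out
    else
      let wi ← step (q.w i)
      let Y' ← step (Y - wi)
      let κ ← step (Y' / Y)
      let σ ← step (wi / Y)
      let mem ← visitLoop G q.a q.b ε κ σ r.supp ⟨r.val, ⟨blank, []⟩, out⟩
      let i' ← step (i + 1)
      mainLoop G q ε k i' Y' mem.next mem.cur mem.out

/-- The initialization: `L ← L_{O_w}(c δ)`, `ε ← c² δ / (2 (L + 1))`, and the initial residue
vector, which is produced by the procedure `load`. -/
noncomputable def initPhase {n : ℕ} (q : Query n) (δ c : ℝ) (load : Comp (SparseVec n)) :
    Comp (ℕ × ℝ × SparseVec n) := do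
  let Δ ← step (c * δ)
  let L ← step (q.oracleL Δ)
  let c2 ← step (c * c)
  let num ← step (c2 * δ)
  let L' ← step (L + 1)
  let den ← step (2 * (L' : ℝ))
  let ε ← step (num / den)
  let r ← load
  return (L, ε, r)

/-- AGP-Static++ with the procedure `load` for the initial residue vector. The work arrays are
all-zero at the start. -/
noncomputable def agpStaticPP {n : ℕ} (G : SimpleGraph (Fin n)) [DecidableRel G.Adj] (q : Query n)
    (δ c : ℝ) (load : Comp (SparseVec n)) : Comp (Fin n → ℝ) := do
  let (L, ε, r) ← initPhase q δ c load
  mainLoop G q ε L 0 1 r 0 0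

/-- The loop of `readInput`. -/
noncomputable def readLoop {n : ℕ} (x : Fin n → ℝ) :
    (vs : List (Fin n)) → (r : SparseVec n) → Comp (SparseVec n)
  | [], r => step r
  | v :: vs, r => do
    let v ← step v
    let xv ← step (x v)
    if (← step (decide (xv = 0))) then
      readLoop x vs r
    else
      let val ← step (Function.update r.val v xv)
      let supp ← step (v :: r.supp)
      readLoop x vs ⟨val, supp⟩

/-- The deterministic initialization `r ← x`, which reads the whole vector. -/
noncomputable def readInput {n : ℕ} (x : Fin n → ℝ) : Comp (SparseVec n) :=
  readLoop x (List.finRange n) ⟨0, []⟩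

/-- `load` is an admissible (possibly randomized) initialization for `x`: it produces a
non-negative vector with the list of its non-zero positions, spends at least one instruction per
non-zero entry that it outputs, and its output has expectation `x`. -/
structure IsInitialization {n : ℕ} (load : Comp (SparseVec n)) (x : Fin n → ℝ) : Prop where
  nonneg : ∀ z ∈ load.law.support, ∀ v, 0 ≤ z.1.val v
  nodup : ∀ z ∈ load.law.support, z.1.supp.Nodup
  mem_supp : ∀ z ∈ load.law.support, ∀ v, v ∈ z.1.supp ↔ z.1.val v ≠ 0
  length_le : ∀ z ∈ load.law.support, z.1.supp.length ≤ z.2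
  unbiased : ∀ v, load.expect (fun r _ => ENNReal.ofReal (r.val v)) = ENNReal.ofReal (x v)

/-- `E[C_init]`: the expected number of instructions of the initialization, plus, if `L ≥ 1`, the
expected number of buckets that are opened at the non-zero entries of the initial vector. -/
noncomputable def expectedInitCost {n : ℕ} (G : SimpleGraph (Fin n)) [DecidableRel G.Adj]
    (q : Query n) (δ c : ℝ) (load : Comp (SparseVec n)) : ℝ≥0∞ :=
  (initPhase q δ c load).expect fun z t =>
    (t : ℝ≥0∞) +
      if z.1 = 0 then 0 else (((z.2.2.supp.map fun u => (buckets G u).length).sum : ℕ) : ℝ≥0∞)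

end AGP

namespace AGP

open MeasureTheory

/-! ## Expectation calculus -/

/-! The expected cost of a query is linear in the residue, so it can be computed backwards. Let `t`
be the amount that `u` owes to its neighbour `v`. The increment `max ε t`, given with probability
`min 1 (t / ε)`, has mean exactly `t` (`prob_mul_max`), and this probability is at most `t / ε`
(`prob_le`). One push therefore moves residue by the propagation matrix in expectation, and creates
at most `1 / ε` times the moved mass of new positions.

Sampling at `u` costs a constant per bucket plus a constant per candidate. Degrees in a bucket
differ by a factor below two and `a ≤ 1`, so `p* ≤ 2 p` (`candProb_le_two_mul_prob`): candidates
exceed the mean sample size at most twofold, and there are at most `log₂ n + 1` buckets.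

A new position prepays the opening of its buckets in the following iteration, which is the source of
the logarithm. `loopCharge` is the resulting future cost of one unit of residue, defined by
recursion on the remaining iterations; `expect_time_mainLoop_le` proves that it bounds the running
time. Unrolled against `x`, the factors `Y_{i+1} / Y_i` telescope and leave `1 / ε` times the sum of
the norms (`ofReal_Y_mul_sum_loopCharge`), with `1 / ε ≤ 4 L / (c² δ)` for `L ≥ 1`. The initial
positions are not prepaid; their buckets are part of the initialization cost.

Only means of sums over a sample enter, so marginal probabilities suffice and independence is never
used beyond them. -/

theorem tsum_pmf_bind {α β : Type} (p : PMF α) (k : α → PMF β) (f : β → ℝ≥0∞) :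
    ∑' b, p.bind k b * f b = ∑' a, p a * ∑' b, k a b * f b := by
  simp only [PMF.bind_apply, ← ENNReal.tsum_mul_right, ← ENNReal.tsum_mul_left, mul_assoc]
  exact ENNReal.tsum_comm

theorem tsum_pmf_pure {α : Type} (a : α) (f : α → ℝ≥0∞) :
    ∑' b, PMF.pure a b * f b = f a := by
  rw [tsum_eq_single a]
  · simp
  · intro b hb; simp [PMF.pure_apply, hb]

theorem tsum_pmf_map {α β : Type} (p : PMF α) (k : α → β) (f : β → ℝ≥0∞) :
    ∑' b, p.map k b * f b = ∑' a, p a * f (k a) := by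
  rw [PMF.map, tsum_pmf_bind]
  simp only [Function.comp_apply, tsum_pmf_pure]

namespace Comp

variable {α β : Type}

@[simp] theorem expect_pure (a : α) (f : α → ℕ → ℝ≥0∞) :
    (pure a : Comp α).expect f = f a 0 :=
  tsum_pmf_pure (a, 0) fun z : α × ℕ => f z.1 z.2

@[simp] theorem expect_step (a : α) (f : α → ℕ → ℝ≥0∞) : (step a).expect f = f a 1 :=
  tsum_pmf_pure (a, 1) fun z : α × ℕ => f z.1 z.2

-- Tower rule, with the clock of the continuation shifted. As a simp lemma it turns a program into
-- nested expectations.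
@[simp] theorem expect_bind (m : Comp α) (k : α → Comp β) (f : β → ℕ → ℝ≥0∞) :
    (m >>= k).expect f = m.expect fun a t => (k a).expect fun b t' => f b (t + t') := by
  change ∑' z, (m.law.bind fun z => (k z.1).law.map fun y => (y.1, z.2 + y.2)) z * f z.1 z.2 = _
  rw [tsum_pmf_bind m.law _ fun z : β × ℕ => f z.1 z.2]
  refine tsum_congr fun z => ?_
  rw [tsum_pmf_map _ _ fun z : β × ℕ => f z.1 z.2]
  rfl

theorem expect_add (m : Comp α) (f g : α → ℕ → ℝ≥0∞) :
    m.expect (fun a t => f a t + g a t) = m.expect f + m.expect g := by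
  simp only [expect, mul_add, ENNReal.tsum_add]

theorem expect_const_mul (m : Comp α) (c : ℝ≥0∞) (f : α → ℕ → ℝ≥0∞) :
    m.expect (fun a t => c * f a t) = c * m.expect f := by
  simp only [expect, mul_left_comm _ c, ENNReal.tsum_mul_left]

@[simp] theorem expect_const (m : Comp α) (c : ℝ≥0∞) : m.expect (fun _ _ => c) = c := by
  simp only [expect, ENNReal.tsum_mul_right, m.law.tsum_coe, one_mul]

theorem expect_finset_sum {ι : Type*} (m : Comp α) (s : Finset ι) (f : ι → α → ℕ → ℝ≥0∞) :
    m.expect (fun a t => ∑ i ∈ s, f i a t) = ∑ i ∈ s, m.expect (f i) := by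
  classical
  induction s using Finset.induction_on with
  | empty => simp
  | insert i s hi ih => simp only [Finset.sum_insert hi, expect_add, ih]

/-- The property `P` holds for every possible result and number of executed instructions. -/
def Always (m : Comp α) (P : α → ℕ → Prop) : Prop := ∀ z ∈ m.law.support, P z.1 z.2

@[simp] theorem always_pure (a : α) (P : α → ℕ → Prop) : (pure a : Comp α).Always P ↔ P a 0 := by
  change (∀ z ∈ (PMF.pure (a, 0)).support, P z.1 z.2) ↔ _
  simp [PMF.support_pure]

@[simp] theorem always_step (a : α) (P : α → ℕ → Prop) : (step a).Always P ↔ P a 1 := by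
  change (∀ z ∈ (PMF.pure (a, 1)).support, P z.1 z.2) ↔ _
  simp [PMF.support_pure]

@[simp] theorem always_bind (m : Comp α) (k : α → Comp β) (P : β → ℕ → Prop) :
    (m >>= k).Always P ↔ m.Always fun a t => (k a).Always fun b t' => P b (t + t') := by
  change (∀ z ∈ (m.law.bind fun z => (k z.1).law.map fun y => (y.1, z.2 + y.2)).support,
    P z.1 z.2) ↔ _
  simp only [PMF.mem_support_bind_iff, PMF.mem_support_map_iff, Always]
  constructor
  · intro h z hz y hy
    exact h _ ⟨z, hz, y, hy, rfl⟩
  · rintro h _ ⟨z, hz, y, hy, rfl⟩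
    exact h z hz y hy

theorem Always.mono {m : Comp α} {P Q : α → ℕ → Prop} (h : m.Always P)
    (hPQ : ∀ a t, P a t → Q a t) : m.Always Q :=
  fun z hz => hPQ _ _ (h z hz)

theorem always_true (m : Comp α) : m.Always fun _ _ => True := fun _ _ => trivial

theorem Always.expect_le {m : Comp α} {f g : α → ℕ → ℝ≥0∞}
    (h : m.Always fun a t => f a t ≤ g a t) : m.expect f ≤ m.expect g := by
  refine ENNReal.tsum_le_tsum fun z => ?_
  by_cases hz : m.law z = 0
  · simp [hz]
  · exact mul_le_mul_right (h z ((PMF.mem_support_iff _ _).2 hz)) _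

theorem expect_mono {m : Comp α} {f g : α → ℕ → ℝ≥0∞} (h : ∀ a t, f a t ≤ g a t) :
    m.expect f ≤ m.expect g :=
  Always.expect_le fun _ _ => h _ _

theorem Always.expect_congr {m : Comp α} {f g : α → ℕ → ℝ≥0∞}
    (h : m.Always fun a t => f a t = g a t) : m.expect f = m.expect g :=
  le_antisymm (Always.expect_le fun z hz => (h z hz).le)
    (Always.expect_le fun z hz => (h z hz).ge)

end Comp

/-! ## Laws of the random draws -/

theorem expect_draw (k : ℕ) (g : unitInterval → ℕ) (hg : Measurable g) (f : ℕ → ℕ → ℝ≥0∞) :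
    (draw k g hg).expect f = ∑' j, volume (g ⁻¹' {j}) * f j k := by
  have : IsProbabilityMeasure ((volume : Measure unitInterval).map g) :=
    Measure.isProbabilityMeasure_map hg.aemeasurable
  change ∑' z, (((volume : Measure unitInterval).map g).toPMF.map fun y => (y, k)) z * f z.1 z.2 = _
  rw [tsum_pmf_map _ _ fun z : ℕ × ℕ => f z.1 z.2]
  refine tsum_congr fun j => ?_
  rw [Measure.toPMF_apply, Measure.map_apply hg (measurableSet_singleton j)]

theorem always_draw (k : ℕ) (g : unitInterval → ℕ) (hg : Measurable g) {P : ℕ → ℕ → Prop}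
    (h : ∀ U, P (g U) k) : (draw k g hg).Always P := by
  have : IsProbabilityMeasure ((volume : Measure unitInterval).map g) :=
    Measure.isProbabilityMeasure_map hg.aemeasurable
  change ∀ z ∈ (((volume : Measure unitInterval).map g).toPMF.map fun y => (y, k)).support,
    P z.1 z.2
  intro z hz
  obtain ⟨j, hj, rfl⟩ := (PMF.mem_support_map_iff _ _ _).1 hz
  rw [PMF.mem_support_iff, Measure.toPMF_apply,
    Measure.map_apply hg (measurableSet_singleton j)] at hj
  obtain ⟨U, hU⟩ := nonempty_of_measure_ne_zero hj
  obtain rfl : g U = j := hU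
  exact h U

theorem expect_coin {p : ℝ} (h0 : 0 ≤ p) (h1 : p ≤ 1) (f : Bool → ℕ → ℝ≥0∞) :
    (coin p).expect f = ENNReal.ofReal p * f true 4 + ENNReal.ofReal (1 - p) * f false 4 := by
  let P : unitInterval := ⟨1 - p, by linarith, by linarith⟩
  have key : ∀ U : unitInterval, 1 ≤ ⌊(U : ℝ) + p⌋₊ ↔ U ∈ Set.Ici P := by
    intro U
    rw [Nat.one_le_floor_iff, Set.mem_Ici, ← Subtype.coe_le_coe]
    change _ ↔ 1 - p ≤ (U : ℝ)
    constructor <;> intro h <;> linarith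
  have hz : (fun U : unitInterval => ⌊(U : ℝ) + p⌋₊) ⁻¹' {0} = Set.Iio P := by
    ext U
    have := key U
    simp only [Set.mem_preimage, Set.mem_singleton_iff, Set.mem_Iio, Set.mem_Ici] at this ⊢
    rw [← not_le, ← this]
    omega
  have hm : Measurable fun U : unitInterval => ⌊(U : ℝ) + p⌋₊ := by fun_prop
  -- All positive values are collected, since the rounding yields `2` when `U = 1` and `p = 1`.
  have hs : ∑' j, volume ((fun U : unitInterval => ⌊(U : ℝ) + p⌋₊) ⁻¹' {j + 1}) =
      ENNReal.ofReal p := by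
    rw [← measure_iUnion]
    · have : ⋃ j, (fun U : unitInterval => ⌊(U : ℝ) + p⌋₊) ⁻¹' {j + 1} = Set.Ici P := by
        ext U
        rw [← key U]
        simp only [Set.mem_iUnion, Set.mem_preimage, Set.mem_singleton_iff]
        exact ⟨fun ⟨j, hj⟩ => by omega, fun h => ⟨⌊(U : ℝ) + p⌋₊ - 1, by omega⟩⟩
      rw [this, unitInterval.volume_Ici]
      simp [P]
    · intro i j hij
      exact Disjoint.preimage _ (by simpa using fun h => hij (by omega))
    · exact fun j => hm (measurableSet_singleton _)
  simp only [coin, Comp.expect_bind, Comp.expect_step, expect_draw]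
  rw [tsum_eq_zero_add' ENNReal.summable, hz]
  simp only [le_add_iff_nonneg_left, zero_le, decide_true, ENNReal.tsum_mul_right, hs]
  rw [unitInterval.volume_Iio, add_comm]
  simp [P]

theorem always_coin (p : ℝ) : (coin p).Always fun _ t => t = 4 := by
  simp only [coin, Comp.always_bind, Comp.always_step]
  exact always_draw _ _ _ fun _ => rfl

/-- As `log (1 - p) < 0`, the quotient is at least `k` exactly when `U ≥ 1 - (1 - p) ^ k`. The fibre
is thus an interval between consecutive such points, up to a null set. -/
theorem volume_geometric {p : ℝ} (h0 : 0 < p) (h1 : p < 1) (j : ℕ) :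
    volume ((fun U : unitInterval => ⌊Real.log (1 - (U : ℝ)) / Real.log (1 - p)⌋₊ + 1) ⁻¹'
      {j + 1}) = ENNReal.ofReal (p * (1 - p) ^ j) := by
  have hq0 : 0 < 1 - p := by linarith
  have hq1 : 1 - p < 1 := by linarith
  have hl : Real.log (1 - p) < 0 := Real.log_neg hq0 hq1
  have hpow : ∀ k : ℕ, (1 - p) ^ k ≤ 1 := fun k => pow_le_one₀ hq0.le hq1.le
  let P : ℕ → unitInterval := fun k =>
    ⟨1 - (1 - p) ^ k, by linarith [hpow k], by linarith [pow_pos hq0 k]⟩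
  have hae : (fun U : unitInterval => ⌊Real.log (1 - (U : ℝ)) / Real.log (1 - p)⌋₊ + 1) ⁻¹'
      {j + 1} =ᵐ[volume] Set.Ico (P j) (P (j + 1)) := by
    -- At `U = 1` the convention `Real.log 0 = 0` puts the point into the fibre `j = 0`, outside its
    -- interval.
    have h1 : ∀ᵐ U : unitInterval, U ≠ 1 := by
      rw [ae_iff]; simp
    filter_upwards [h1] with U hU
    have hU1 : (U : ℝ) < 1 := lt_of_le_of_ne U.2.2 fun h => hU (Subtype.ext h)
    have hpos : 0 < 1 - (U : ℝ) := by linarith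
    have hX : 0 ≤ Real.log (1 - (U : ℝ)) / Real.log (1 - p) :=
      div_nonneg_of_nonpos (Real.log_nonpos hpos.le (by linarith [U.2.1])) hl.le
    have hle : ∀ k : ℕ, (k : ℝ) ≤ Real.log (1 - (U : ℝ)) / Real.log (1 - p) ↔
        P k ≤ U := by
      intro k
      rw [le_div_iff_of_neg hl, ← Real.log_pow, Real.log_le_log_iff hpos (pow_pos hq0 k),
        ← Subtype.coe_le_coe]
      change _ ↔ 1 - (1 - p) ^ k ≤ (U : ℝ)
      constructor <;> intro h <;> linarith
    apply propext
    change (⌊Real.log (1 - (U : ℝ)) / Real.log (1 - p)⌋₊ + 1 = j + 1) ↔ P j ≤ U ∧ U < P (j + 1)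
    rw [Nat.add_right_cancel_iff, Nat.floor_eq_iff hX, hle, ← not_le, ← not_le, ← hle (j + 1)]
    push_cast
    rfl
  rw [measure_congr hae, unitInterval.volume_Ico]
  congr 1
  change (1 - (1 - p) ^ (j + 1)) - (1 - (1 - p) ^ j) = _
  ring

/-- The expectation of `h` at the number of failures before the first success. -/
noncomputable def geoSum (p : ℝ) (h : ℕ → ℝ≥0∞) : ℝ≥0∞ :=
  ∑' j, ENNReal.ofReal (p * (1 - p) ^ j) * h j

theorem expect_boundedGeo {p : ℝ} (h0 : 0 < p) (h1 : p < 1) (N : ℕ) (f : ℕ → ℕ → ℝ≥0∞) :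
    (boundedGeo p N).expect f = geoSum p fun j => f (min (j + 1) (N + 1)) 11 := by
  simp only [boundedGeo, Comp.expect_bind, Comp.expect_step, h0, decide_true, if_true, expect_draw,
    geoSum]
  rw [tsum_eq_zero_add' ENNReal.summable]
  simp only [volume_geometric h0 h1]
  have : (fun U : unitInterval => ⌊Real.log (1 - (U : ℝ)) / Real.log (1 - p)⌋₊ + 1) ⁻¹' {0} = ∅ := by
    ext U; simp
  rw [this]
  simp

theorem expect_boundedGeo_zero (N : ℕ) (f : ℕ → ℕ → ℝ≥0∞) :
    (boundedGeo 0 N).expect f = f (N + 1) 2 := by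
  simp [boundedGeo]

theorem always_boundedGeo (p : ℝ) (N : ℕ) :
    (boundedGeo p N).Always fun j t => 1 ≤ j ∧ t ≤ 11 := by
  by_cases h : 0 < p
  · simp only [boundedGeo, Comp.always_bind, Comp.always_step, h, decide_true, if_true]
    exact always_draw _ _ _ fun _ => by simp
  · simp [boundedGeo, h]

/-- Memorylessness: condition on the first trial. -/
theorem geoSum_zero_add {p : ℝ} (h1 : p < 1) (h : ℕ → ℝ≥0∞) :
    geoSum p h = ENNReal.ofReal p * h 0 +
      ENNReal.ofReal (1 - p) * geoSum p fun j => h (j + 1) := by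
  rw [geoSum, tsum_eq_zero_add' ENNReal.summable, geoSum, ← ENNReal.tsum_mul_left]
  congr 1
  · simp
  · refine tsum_congr fun j => ?_
    rw [← mul_assoc, ← ENNReal.ofReal_mul (by linarith)]
    congr 2
    ring

theorem geoSum_const {p : ℝ} (h0 : 0 < p) (h1 : p < 1) (c : ℝ≥0∞) :
    geoSum p (fun _ => c) = c := by
  have hs : HasSum (fun j : ℕ => p * (1 - p) ^ j) 1 := by
    have := (hasSum_geometric_of_lt_one (r := 1 - p) (by linarith) (by linarith)).mul_left p
    simpa [h0.ne'] using this
  rw [geoSum, ENNReal.tsum_mul_right, ← ENNReal.ofReal_tsum_of_nonneg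
    (fun j => mul_nonneg h0.le (pow_nonneg (by linarith) j)) hs.summable, hs.tsum_eq]
  simp

theorem geoSum_add (p : ℝ) (f g : ℕ → ℝ≥0∞) :
    geoSum p (fun j => f j + g j) = geoSum p f + geoSum p g := by
  simp only [geoSum, mul_add, ENNReal.tsum_add]

end AGP

namespace AGP

/-! ## The subset sampling procedure -/

variable {n : ℕ}

/-- One jump: the element hit contributes `g`, and everything behind it contributes `p` times its
sum. By conditioning on the head, this is the recursion that makes `p * ∑ g` the mean of the whole
jump process. -/
theorem geoSum_list {p : ℝ} (h0 : 0 < p) (h1 : p < 1) (g : Fin n → ℝ≥0∞) (l : List (Fin n)) :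
    geoSum p (fun j => ((l.drop j).take 1 |>.map g).sum +
      ENNReal.ofReal p * ((l.drop (j + 1)).map g).sum) = ENNReal.ofReal p * (l.map g).sum := by
  induction l with
  | nil => simp [geoSum]
  | cons v l ih =>
    rw [geoSum_zero_add h1]
    simp only [List.drop_succ_cons, ih]
    simp only [List.drop_zero, List.take_succ_cons, List.take_zero, List.map_cons, List.map_nil,
      List.sum_cons, List.sum_nil, add_zero, mul_add, add_assoc]
    congr 1
    rw [← add_mul, ← ENNReal.ofReal_add h0.le (by linarith)]
    simp

theorem expect_jumpLoop {p : ℝ} (h0 : 0 ≤ p) (h1 : p < 1) (B : List (Fin n))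
    (g : Fin n → ℝ≥0∞) (fuel : ℕ) : ∀ (y : ℕ) (cand : List (Fin n)), y ≤ B.length →
    B.length < y + fuel →
    (jumpLoop p B fuel y cand).expect (fun c _ => (c.map g).sum) =
      (cand.map g).sum + ENNReal.ofReal p * ((B.drop y).map g).sum := by
  induction fuel with
  | zero => intro y cand hy hf; omega
  | succ fuel ih =>
    intro y cand hy hf
    -- For `p = 0` the variate is deterministic and jumps past the end.
    rcases h0.eq_or_lt with rfl | hp
    · simp only [jumpLoop, Comp.expect_bind, Comp.expect_step, expect_boundedGeo_zero]
      have : B.length < y + (B.length + 1) := by omega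
      simp [this]
    · simp only [jumpLoop, Comp.expect_bind, Comp.expect_step, expect_boundedGeo hp h1]
      rw [← geoSum_list hp h1 g (B.drop y), ← geoSum_const hp h1 (cand.map g).sum, ← geoSum_add]
      congr 1
      funext j
      simp only [List.drop_drop]
      by_cases hj : B.length < y + (j + 1)
      · have h2 : B.length < y + min (j + 1) (B.length + 1) := by omega
        have h3 : B.drop (y + j) = [] := List.drop_eq_nil_of_le (by omega)
        have h4 : B.drop (y + (j + 1)) = [] := List.drop_eq_nil_of_le (by omega)
        simp only [h2, decide_true, if_true, Comp.expect_pure, h3, h4]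
        simp
      · have h2 : min (j + 1) (B.length + 1) = j + 1 := by omega
        have h3 : y + j < B.length := by omega
        rw [h2]
        have h4 : B[y + (j + 1) - 1]? = some B[y + j] := by
          rw [List.getElem?_eq_some_iff]; exact ⟨h3, rfl⟩
        simp only [hj, decide_false, Bool.false_eq_true, if_false, h4, Comp.expect_bind,
          Comp.expect_step]
        rw [ih _ _ (by omega) (by omega), List.drop_eq_getElem_cons h3]
        simp only [List.map_cons, List.sum_cons, List.take_succ_cons, List.take_zero,
          List.map_nil, List.sum_nil, add_zero]
        ring

/-- A round costs at most 14 instructions, or 16 if it pushes a candidate, and at most one round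
pushes none. Hence a bound on every path by the number of candidates. -/
theorem always_jumpLoop (p : ℝ) (B : List (Fin n)) (fuel : ℕ) :
    ∀ (y : ℕ) (cand : List (Fin n)),
    (jumpLoop p B fuel y cand).Always fun c t => t + 16 * cand.length ≤ 14 + 16 * c.length := by
  induction fuel with
  | zero => intro y cand; simp [jumpLoop]
  | succ fuel ih =>
    intro y cand
    simp only [jumpLoop, Comp.always_bind, Comp.always_step]
    refine (always_boundedGeo p _).mono fun j t ht => ?_
    split
    · simp only [Comp.always_pure]; omega
    · split
      · simp only [Comp.always_pure]; omega
      · simp only [Comp.always_bind, Comp.always_step]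
        refine (ih _ _).mono fun c t' h => ?_
        simp only [List.length_cons] at h
        omega

theorem always_mem_jumpLoop (p : ℝ) (B : List (Fin n)) (fuel : ℕ) :
    ∀ (y : ℕ) (cand : List (Fin n)), (∀ v ∈ cand, v ∈ B) →
    (jumpLoop p B fuel y cand).Always fun c _ => ∀ v ∈ c, v ∈ B := by
  induction fuel with
  | zero => intro y cand h; simpa [jumpLoop] using h
  | succ fuel ih =>
    intro y cand h
    simp only [jumpLoop, Comp.always_bind, Comp.always_step]
    refine (Comp.always_true _).mono fun j t _ => ?_
    split
    · simpa only [Comp.always_pure] using h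
    · split
      · simpa only [Comp.always_pure] using h
      · rename_i v hv
        simp only [Comp.always_bind, Comp.always_step]
        refine ih _ _ fun w hw => ?_
        rcases List.mem_cons.1 hw with rfl | hw
        · exact List.mem_of_getElem? hv
        · exact h w hw

/-! ### Thinning of the candidates -/

variable (G : SimpleGraph (Fin n)) [DecidableRel G.Adj]

theorem expect_acceptLoop (a s p : ℝ) (g : Fin n → ℝ≥0∞) (cand : List (Fin n)) :
    (∀ v ∈ cand, 0 ≤ prob G a s v / p ∧ prob G a s v / p ≤ 1) → ∀ T : List (Fin n),
    (acceptLoop G a s p cand T).expect (fun c _ => (c.map g).sum) =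
      (T.map g).sum + (cand.map fun v => ENNReal.ofReal (prob G a s v / p) * g v).sum := by
  induction cand with
  | nil => intro _ T; simp [acceptLoop]
  | cons v cand ih =>
    intro h T
    have hv := h v (by simp)
    have ih := ih fun w hw => h w (by simp [hw])
    simp only [acceptLoop, Comp.expect_bind, Comp.expect_step]
    change (coin (prob G a s v / p)).expect _ = _
    rw [expect_coin hv.1 hv.2]
    simp only [if_true, Bool.false_eq_true, if_false, Comp.expect_bind, Comp.expect_step, ih,
      List.map_cons, List.sum_cons]
    have h1 : ENNReal.ofReal (prob G a s v / p) + ENNReal.ofReal (1 - prob G a s v / p) = 1 := by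
      rw [← ENNReal.ofReal_add hv.1 (by linarith [hv.2])]; simp
    generalize (T.map g).sum = x
    generalize (cand.map fun v => ENNReal.ofReal (prob G a s v / p) * g v).sum = y
    calc _ = ENNReal.ofReal (prob G a s v / p) * g v +
        (ENNReal.ofReal (prob G a s v / p) + ENNReal.ofReal (1 - prob G a s v / p)) * (x + y) := by
          ring
      _ = _ := by rw [h1]; ring

theorem always_acceptLoop (a s p : ℝ) (cand : List (Fin n)) : ∀ T : List (Fin n),
    (acceptLoop G a s p cand T).Always fun _ t => t ≤ 1 + 11 * cand.length := by
  induction cand with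
  | nil => intro T; simp [acceptLoop]
  | cons v cand ih =>
    intro T
    simp only [acceptLoop, Comp.always_bind, Comp.always_step]
    refine (always_coin _).mono fun b t ht => ?_
    split
    · simp only [Comp.always_bind, Comp.always_step]
      refine (ih _).mono fun c t' h => ?_
      simp only [List.length_cons]
      omega
    · refine (ih _).mono fun c t' h => ?_
      simp only [List.length_cons]
      omega

/-- All vertices of the bucket have degree between `2 ^ j` and `2 ^ (j + 1)`. -/
def IsDegreeBucket (B : ℕ × List (Fin n)) : Prop :=
  ∀ v ∈ B.2, 2 ^ B.1 ≤ G.degree v ∧ G.degree v < 2 ^ (B.1 + 1)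

variable {G}

theorem prob_nonneg {a s : ℝ} (hs : 0 ≤ s) (v : Fin n) : 0 ≤ prob G a s v :=
  le_min zero_le_one (by positivity)

/-- The candidate probability `p*` of the bucket with index `j`. -/
noncomputable def candProb (a s : ℝ) (j : ℕ) : ℝ := min 1 (s / ((2 : ℝ) ^ j) ^ a)

theorem candProb_nonneg {a s : ℝ} (hs : 0 ≤ s) (j : ℕ) : 0 ≤ candProb a s j :=
  le_min zero_le_one (by positivity)

theorem prob_le_candProb {a s : ℝ} (ha : 0 ≤ a) (hs : 0 ≤ s) {j : ℕ} {v : Fin n}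
    (h : 2 ^ j ≤ G.degree v) : prob G a s v ≤ candProb a s j := by
  refine min_le_min le_rfl (div_le_div_of_nonneg_left hs (by positivity) ?_)
  exact Real.rpow_le_rpow (by positivity) (by exact_mod_cast h) ha

/-- Within a bucket `d ^ a ≤ 2 ^ a * (2 ^ j) ^ a`, and `2 ^ a ≤ 2` because `a ≤ 1`. -/
theorem candProb_le_two_mul_prob {a s : ℝ} (ha : 0 ≤ a) (ha1 : a ≤ 1) (hs : 0 ≤ s) {j : ℕ}
    {v : Fin n} (h0 : 2 ^ j ≤ G.degree v) (h : G.degree v < 2 ^ (j + 1)) :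
    candProb a s j ≤ 2 * prob G a s v := by
  have h1 : (G.degree v : ℝ) ^ a ≤ 2 * ((2 : ℝ) ^ j) ^ a := by
    calc (G.degree v : ℝ) ^ a ≤ ((2 : ℝ) * 2 ^ j) ^ a := by
          refine Real.rpow_le_rpow (by positivity) ?_ ha
          rw [← pow_succ']
          exact_mod_cast h.le
      _ = (2 : ℝ) ^ a * ((2 : ℝ) ^ j) ^ a := Real.mul_rpow (by positivity) (by positivity)
      _ ≤ 2 * ((2 : ℝ) ^ j) ^ a := by
          gcongr
          calc (2 : ℝ) ^ a ≤ 2 ^ (1 : ℝ) := Real.rpow_le_rpow_of_exponent_le (by norm_num) ha1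
            _ = 2 := by simp
  have hd : 0 < (G.degree v : ℝ) := by
    exact_mod_cast (pow_pos two_pos j).trans_le h0
  have h2 : s / ((2 : ℝ) ^ j) ^ a ≤ 2 * (s / (G.degree v : ℝ) ^ a) := by
    rw [← mul_div_assoc, div_le_div_iff₀ (by positivity) (by positivity)]
    nlinarith
  unfold prob candProb
  rcases min_cases 1 (s / (G.degree v : ℝ) ^ a) with h | h <;> rw [h.1]
  · linarith [min_le_left 1 (s / ((2 : ℝ) ^ j) ^ a)]
  · linarith [min_le_right 1 (s / ((2 : ℝ) ^ j) ^ a)]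

theorem prob_div_candProb {a s : ℝ} (ha : 0 ≤ a) (hs : 0 ≤ s) {j : ℕ} {v : Fin n}
    (h : 2 ^ j ≤ G.degree v) :
    0 ≤ prob G a s v / candProb a s j ∧ prob G a s v / candProb a s j ≤ 1 :=
  ⟨div_nonneg (prob_nonneg hs v) (candProb_nonneg hs j),
    div_le_one_of_le₀ (prob_le_candProb ha hs h) (candProb_nonneg hs j)⟩

theorem list_sum_const_mul {α : Type*} (c : ℝ≥0∞) (f : α → ℝ≥0∞) (l : List α) :
    (l.map fun v => c * f v).sum = c * (l.map f).sum :=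
  List.sum_map_mul_left l f c

theorem list_sum_one {α : Type*} (l : List α) : (l.map fun _ => (1 : ℝ≥0∞)).sum = l.length := by
  simp

/-- Being a candidate and being accepted multiply to `p* * (p / p*) = p`. -/
theorem expect_sampleBucket {a s : ℝ} (ha : 0 ≤ a) (hs : 0 ≤ s) (g : Fin n → ℝ≥0∞)
    {B : ℕ × List (Fin n)} (hB : IsDegreeBucket G B) (T : List (Fin n)) :
    (sampleBucket G a s B T).expect (fun c _ => (c.map g).sum) =
      (T.map g).sum + (B.2.map fun v => ENNReal.ofReal (prob G a s v) * g v).sum := by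
  have hacc : ∀ v ∈ B.2, 0 ≤ prob G a s v / candProb a s B.1 ∧
      prob G a s v / candProb a s B.1 ≤ 1 := fun v hv => prob_div_candProb ha hs (hB v hv).1
  simp only [sampleBucket, Comp.expect_bind, Comp.expect_step]
  rw [show min 1 (s / ((2 : ℝ) ^ B.1) ^ a) = candProb a s B.1 from rfl]
  by_cases h : candProb a s B.1 < 1
  · simp only [h, decide_true, if_true, Comp.expect_bind]
    have hsub := always_mem_jumpLoop (candProb a s B.1) B.2 (B.2.length + 1) 0 [] (by simp)
    rw [(hsub.mono fun c t hc => expect_acceptLoop G a s (candProb a s B.1) g c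
      (fun v hv => hacc v (hc v hv)) T).expect_congr, Comp.expect_add, Comp.expect_const,
      expect_jumpLoop (candProb_nonneg hs _) h _ _ _ _ _ (Nat.zero_le _) (by omega)]
    simp only [List.map_nil, List.sum_nil, zero_add, List.drop_zero, ← list_sum_const_mul]
    congr 2
    refine List.map_congr_left fun v hv => ?_
    rw [← mul_assoc, ← ENNReal.ofReal_mul (candProb_nonneg hs _)]
    congr 2
    -- If `p* = 0`, the quotient is `0` by convention, which is right since `p ≤ p*` forces `p = 0`.
    rcases (candProb_nonneg (a := a) hs B.1).eq_or_lt with h0 | h0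
    · have := prob_le_candProb (G := G) ha hs (hB v hv).1
      have := prob_nonneg (G := G) (a := a) hs v
      rw [← h0]; simp; linarith
    · field_simp
  · have h1 : candProb a s B.1 = 1 := le_antisymm (min_le_left _ _) (not_lt.1 h)
    simp only [h, decide_false, Bool.false_eq_true, if_false]
    rw [expect_acceptLoop G a s _ g _ hacc, h1]
    simp

theorem expect_time_sampleBucket {a s : ℝ} (ha : 0 ≤ a) (ha1 : a ≤ 1) (hs : 0 ≤ s)
    {B : ℕ × List (Fin n)} (hB : IsDegreeBucket G B) (T : List (Fin n)) :
    (sampleBucket G a s B T).expect (fun _ t => (t : ℝ≥0∞)) ≤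
      20 + 54 * (B.2.map fun v => ENNReal.ofReal (prob G a s v)).sum := by
  have key : ENNReal.ofReal (candProb a s B.1) * B.2.length ≤
      2 * (B.2.map fun v => ENNReal.ofReal (prob G a s v)).sum := by
    rw [← list_sum_one, ← list_sum_const_mul, ← list_sum_const_mul]
    refine List.sum_le_sum fun v hv => ?_
    rw [mul_one, ← ENNReal.ofReal_ofNat 2, ← ENNReal.ofReal_mul (by norm_num)]
    exact ENNReal.ofReal_le_ofReal (candProb_le_two_mul_prob ha ha1 hs (hB v hv).1 (hB v hv).2)
  simp only [sampleBucket, Comp.expect_bind, Comp.expect_step]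
  rw [show min 1 (s / ((2 : ℝ) ^ B.1) ^ a) = candProb a s B.1 from rfl]
  by_cases h : candProb a s B.1 < 1
  · simp only [h, decide_true, if_true, Comp.expect_bind]
    -- 20 = 5 set-up steps + 14 for the jumps + 1 for the acceptance loop; 27 = 16 + 11 per
    -- candidate. The factor `p* ≤ 2 p` then gives 54.
    calc _ ≤ (jumpLoop (candProb a s B.1) B.2 (B.2.length + 1) 0 []).expect
          (fun c _ => 20 + 27 * (c.map fun _ => (1 : ℝ≥0∞)).sum) := by
          refine ((always_jumpLoop _ _ _ _ _).mono fun c t h => ?_).expect_le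
          refine (((always_acceptLoop G a s _ c T).mono fun c' t' h' => ?_).expect_le).trans
            (Comp.expect_const _ _).le
          rw [list_sum_one]
          simp only [List.length_nil] at h
          norm_cast
          omega
      _ = 20 + 27 * (ENNReal.ofReal (candProb a s B.1) * B.2.length) := by
          rw [Comp.expect_add, Comp.expect_const, Comp.expect_const_mul,
            expect_jumpLoop (candProb_nonneg hs _) h _ _ _ _ _ (Nat.zero_le _) (by omega)]
          simp
      _ ≤ 20 + 27 * (2 * (B.2.map fun v => ENNReal.ofReal (prob G a s v)).sum) := by gcongr
      _ = _ := by ring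
  · have h1 : candProb a s B.1 = 1 := le_antisymm (min_le_left _ _) (not_lt.1 h)
    simp only [h, decide_false, Bool.false_eq_true, if_false]
    rw [h1] at key
    simp only [ENNReal.ofReal_one, one_mul] at key
    calc _ ≤ (20 + 27 * (B.2.length : ℝ≥0∞)) := by
          refine (((always_acceptLoop G a s _ B.2 T).mono fun c' t' h' => ?_).expect_le).trans
            (Comp.expect_const _ _).le
          norm_cast
          omega
      _ ≤ 20 + 27 * (2 * (B.2.map fun v => ENNReal.ofReal (prob G a s v)).sum) := by gcongr
      _ = _ := by ring

theorem expect_bucketLoop {a s : ℝ} (ha : 0 ≤ a) (hs : 0 ≤ s) (g : Fin n → ℝ≥0∞)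
    (Bs : List (ℕ × List (Fin n))) : (∀ B ∈ Bs, IsDegreeBucket G B) → ∀ T : List (Fin n),
    (bucketLoop G a s Bs T).expect (fun c _ => (c.map g).sum) = (T.map g).sum +
      (Bs.map fun B => (B.2.map fun v => ENNReal.ofReal (prob G a s v) * g v).sum).sum := by
  induction Bs with
  | nil => intro _ T; simp [bucketLoop]
  | cons B Bs ih =>
    intro h T
    have ih := ih fun B hB => h B (by simp [hB])
    simp only [bucketLoop, Comp.expect_bind, Comp.expect_step, ih, Comp.expect_add,
      Comp.expect_const, expect_sampleBucket ha hs g (h B (by simp)), List.map_cons,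
      List.sum_cons, add_assoc]

theorem expect_time_bucketLoop {a s : ℝ} (ha : 0 ≤ a) (ha1 : a ≤ 1) (hs : 0 ≤ s)
    (Bs : List (ℕ × List (Fin n))) : (∀ B ∈ Bs, IsDegreeBucket G B) → ∀ T : List (Fin n),
    (bucketLoop G a s Bs T).expect (fun _ t => (t : ℝ≥0∞)) ≤ 1 + 21 * Bs.length +
      54 * (Bs.map fun B => (B.2.map fun v => ENNReal.ofReal (prob G a s v)).sum).sum := by
  induction Bs with
  | nil => intro _ T; simp [bucketLoop]
  | cons B Bs ih =>
    intro h T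
    have ih := ih fun B hB => h B (by simp [hB])
    simp only [bucketLoop, Comp.expect_bind, Comp.expect_step, Nat.cast_add, Nat.cast_one,
      List.map_cons, List.sum_cons, List.length_cons, Comp.expect_add, Comp.expect_const]
    calc _ ≤ 1 + ((20 + 54 * (B.2.map fun v => ENNReal.ofReal (prob G a s v)).sum) +
          (1 + 21 * Bs.length +
      54 * (Bs.map fun B => (B.2.map fun v => ENNReal.ofReal (prob G a s v)).sum).sum)) := by
          gcongr
          · exact expect_time_sampleBucket ha ha1 hs (h B (by simp)) T
          · exact (Comp.expect_mono fun T' t => ih T').trans (Comp.expect_const _ _).le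
      _ = _ := by ring

/-! ### From buckets to neighbourhoods -/

variable (G)

theorem isDegreeBucket_of_mem {u : Fin n} {B : ℕ × List (Fin n)} (hB : B ∈ buckets G u) :
    IsDegreeBucket G B := by
  simp only [buckets, List.mem_filter, List.mem_map] at hB
  obtain ⟨⟨j, _, rfl⟩, _⟩ := hB
  intro v hv
  simp only [bucket, List.mem_filter, decide_eq_true_eq] at hv
  exact hv.2.2

theorem length_buckets_le (u : Fin n) : (buckets G u).length ≤ Nat.log 2 n + 1 := by
  refine (List.length_filter_le _ _).trans ?_
  simp

/-- A neighbour has positive degree, so it lies in exactly one bucket, with index `Nat.log 2` of its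
degree; discarded empty buckets add nothing. -/
theorem sum_buckets (u : Fin n) (f : Fin n → ℝ≥0∞) :
    ((buckets G u).map fun B => (B.2.map f).sum).sum = ∑ v ∈ G.neighborFinset u, f v := by
  have h1 : ∀ l : List (ℕ × List (Fin n)),
      ((l.filter fun B => B.2 ≠ []).map fun B => (B.2.map f).sum).sum =
        (l.map fun B => (B.2.map f).sum).sum := by
    intro l
    induction l with
    | nil => rfl
    | cons B l ih =>
      by_cases h : B.2 = []
      · simpa [h] using ih
      · simpa [h] using congrArg ((B.2.map f).sum + ·) ih
  have h2 : ∀ j, ((bucket G u j).map f).sum =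
      ∑ v ∈ G.neighborFinset u, if Nat.log 2 (G.degree v) = j then f v else 0 := by
    intro j
    have hnd : (bucket G u j).Nodup := (List.nodup_finRange n).filter _
    rw [← List.sum_toFinset f hnd, ← Finset.sum_filter]
    refine Finset.sum_congr ?_ fun _ _ => rfl
    ext v
    simp only [bucket, List.mem_toFinset, List.mem_filter, List.mem_finRange, true_and,
      decide_eq_true_eq, Finset.mem_filter, SimpleGraph.mem_neighborFinset]
    refine and_congr_right fun hv => ?_
    have hd : G.degree v ≠ 0 := by
      rw [← Nat.pos_iff_ne_zero, SimpleGraph.degree_pos_iff_exists_adj]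
      exact ⟨u, hv.symm⟩
    rw [Nat.log_eq_iff (Or.inr ⟨by norm_num, hd⟩)]
  rw [buckets, h1, List.map_map]
  simp only [Function.comp_def, h2]
  rw [← List.sum_toFinset _ List.nodup_range, Finset.sum_comm]
  refine Finset.sum_congr rfl fun v hv => ?_
  rw [Finset.sum_ite_eq, if_pos]
  simp only [List.mem_toFinset, List.mem_range]
  refine Nat.lt_succ_of_le (Nat.log_mono_right ?_)
  exact (G.degree_lt_card_verts v).le.trans (by simp)

theorem expect_sampleNeighbours {a s : ℝ} (ha : 0 ≤ a) (hs : 0 ≤ s) (g : Fin n → ℝ≥0∞)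
    (u : Fin n) : (sampleNeighbours G a s u).expect (fun c _ => (c.map g).sum) =
      ∑ v ∈ G.neighborFinset u, ENNReal.ofReal (prob G a s v) * g v := by
  rw [sampleNeighbours, expect_bucketLoop ha hs g _ fun B => isDegreeBucket_of_mem G, sum_buckets]
  simp

theorem expect_time_sampleNeighbours {a s : ℝ} (ha : 0 ≤ a) (ha1 : a ≤ 1) (hs : 0 ≤ s)
    (u : Fin n) : (sampleNeighbours G a s u).expect (fun _ t => (t : ℝ≥0∞)) ≤
      1 + 21 * (buckets G u).length +
        54 * ∑ v ∈ G.neighborFinset u, ENNReal.ofReal (prob G a s v) := by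
  rw [sampleNeighbours, ← sum_buckets]
  exact expect_time_bucketLoop ha ha1 hs _ (fun B => isDegreeBucket_of_mem G) _

theorem ofReal_meanSize {a s : ℝ} (hs : 0 ≤ s) (u : Fin n) :
    ENNReal.ofReal (meanSize G a s u) =
      ∑ v ∈ G.neighborFinset u, ENNReal.ofReal (prob G a s v) :=
  ENNReal.ofReal_sum_of_nonneg fun v _ => prob_nonneg hs v

/-- For `n ≥ 2` the left side is at most `3 log n / log 2`, and `3 / log 2 < 5`. This absorbs all
additive constants into the logarithm. -/
theorem log_two_add_two_le (hn : 2 ≤ n) : (Nat.log 2 n : ℝ) + 2 ≤ 5 * Real.log n := by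
  have h2 : (0.6931471803 : ℝ) < Real.log 2 := Real.log_two_gt_d9
  have hn0 : n ≠ 0 := by omega
  have h1 : (Nat.log 2 n : ℝ) * Real.log 2 ≤ Real.log n := by
    rw [← Real.log_pow]
    refine Real.log_le_log (by positivity) ?_
    exact_mod_cast Nat.pow_log_le_self 2 hn0
  have h3 : Real.log 2 ≤ Real.log n := Real.log_le_log (by norm_num) (by exact_mod_cast hn)
  have h4 : (0 : ℝ) ≤ Nat.log 2 n := Nat.cast_nonneg _
  nlinarith

theorem expectedTime_sampleNeighbours_le (hn : 2 ≤ n) {a s : ℝ} (ha : 0 ≤ a) (ha1 : a ≤ 1)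
    (hs : 0 ≤ s) (u : Fin n) : (sampleNeighbours G a s u).expectedTime ≤
      105 * ENNReal.ofReal (meanSize G a s u + Real.log n) := by
  have hμ : 0 ≤ meanSize G a s u := Finset.sum_nonneg fun v _ => prob_nonneg hs v
  refine (expect_time_sampleNeighbours G ha ha1 hs u).trans ?_
  rw [← ofReal_meanSize G hs]
  have hlog := log_two_add_two_le hn
  have hlog0 : 0 ≤ Real.log n := Real.log_natCast_nonneg n
  have hb : ((buckets G u).length : ℝ) ≤ Nat.log 2 n + 1 := by
    exact_mod_cast length_buckets_le G u
  calc _ = ENNReal.ofReal (1 + 21 * (buckets G u).length + 54 * meanSize G a s u) := by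
        rw [ENNReal.ofReal_add (by positivity) (by positivity),
          ENNReal.ofReal_add (by positivity) (by positivity), ENNReal.ofReal_mul (by positivity),
          ENNReal.ofReal_mul (by positivity)]
        simp
    _ ≤ ENNReal.ofReal (105 * (meanSize G a s u + Real.log n)) := by
        -- With `ℓ = Nat.log 2 n`: `1 + 21 (ℓ + 1) ≤ 21 (ℓ + 2) ≤ 105 log n`.
        refine ENNReal.ofReal_le_ofReal ?_
        linarith
    _ = _ := by rw [ENNReal.ofReal_mul (by positivity)]; simp

end AGP

namespace AGP

/-! ## One iteration of the query algorithm -/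

variable {n : ℕ}

/-- The vector is non-negative and its list of non-zero positions is correct. -/
structure SparseVec.Valid (r : SparseVec n) : Prop where
  nonneg : ∀ v, 0 ≤ r.val v
  nodup : r.supp.Nodup
  mem_supp : ∀ v, v ∈ r.supp ↔ r.val v ≠ 0

/-- The potential that charges `D` for each listed position and `h v` per unit of residue at `v`. -/
noncomputable def SparseVec.potential (D : ℝ≥0∞) (h : Fin n → ℝ≥0∞) (r : SparseVec n) : ℝ≥0∞ :=
  D * r.supp.length + ∑ v, ENNReal.ofReal (r.val v) * h v

theorem SparseVec.valid_zero : (⟨0, []⟩ : SparseVec n).Valid :=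
  ⟨fun _ => le_rfl, List.nodup_nil, by simp⟩

theorem SparseVec.potential_zero (D : ℝ≥0∞) (h : Fin n → ℝ≥0∞) :
    (⟨0, []⟩ : SparseVec n).potential D h = 0 := by
  simp [potential]

theorem sum_ofReal_update {z : Fin n → ℝ} {v : Fin n} {t : ℝ} (hz : 0 ≤ z v) (ht : 0 ≤ t)
    (h : Fin n → ℝ≥0∞) :
    ∑ w, ENNReal.ofReal (Function.update z v (z v + t) w) * h w =
      ∑ w, ENNReal.ofReal (z w) * h w + ENNReal.ofReal t * h v := by
  rw [← Finset.add_sum_erase _ _ (Finset.mem_univ v), ← Finset.add_sum_erase _ _ (Finset.mem_univ v)]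
  have : ∑ w ∈ Finset.univ.erase v, ENNReal.ofReal (Function.update z v (z v + t) w) * h w =
      ∑ w ∈ Finset.univ.erase v, ENNReal.ofReal (z w) * h w :=
    Finset.sum_congr rfl fun w hw => by rw [Function.update_of_ne (Finset.ne_of_mem_erase hw)]
  rw [this, Function.update_self, ENNReal.ofReal_add hz ht]
  ring

/-- `D` is needed only when the entry was zero. Positivity of `t` excludes cancellation and keeps
the list of positions exact. -/
theorem always_addTo (D : ℝ≥0∞) (h : Fin n → ℝ≥0∞) {r : SparseVec n} (hr : r.Valid) (v : Fin n)
    {t : ℝ} (ht : 0 < t) : (r.addTo v t).Always fun r' k => r'.Valid ∧ k ≤ 5 ∧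
      r'.potential D h ≤ r.potential D h + (D + ENNReal.ofReal t * h v) := by
  have hne : r.val v + t ≠ 0 := (add_pos_of_nonneg_of_pos (hr.nonneg v) ht).ne'
  have hnn : ∀ w, 0 ≤ Function.update r.val v (r.val v + t) w := by
    intro w
    rcases eq_or_ne w v with rfl | hw
    · simpa using add_nonneg (hr.nonneg w) ht.le
    · simpa [hw] using hr.nonneg w
  simp only [SparseVec.addTo, Comp.always_bind, Comp.always_step]
  by_cases h0 : r.val v = 0
  · simp only [h0, decide_true, if_true, Comp.always_bind, Comp.always_step, Comp.always_pure]
    rw [← h0]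
    refine ⟨⟨hnn, ?_, ?_⟩, by norm_num, ?_⟩
    · exact List.nodup_cons.2 ⟨fun hv => (hr.mem_supp v).1 hv h0, hr.nodup⟩
    · intro w
      rcases eq_or_ne w v with rfl | hw
      · simpa using hne
      · simpa [hw] using hr.mem_supp w
    · simp only [SparseVec.potential, sum_ofReal_update (hr.nonneg v) ht.le, List.length_cons,
        Nat.cast_add, Nat.cast_one]
      apply le_of_eq
      ring
  · simp only [h0, decide_false, Bool.false_eq_true, if_false, Comp.always_pure]
    refine ⟨⟨hnn, hr.nodup, ?_⟩, by norm_num, ?_⟩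
    · intro w
      rcases eq_or_ne w v with rfl | hw
      · simpa [hne] using (hr.mem_supp w).2 h0
      · simpa [hw] using hr.mem_supp w
    · simp only [SparseVec.potential, sum_ofReal_update (hr.nonneg v) ht.le, add_assoc]
      gcongr
      exact le_add_self

variable (G : SimpleGraph (Fin n)) [DecidableRel G.Adj]

theorem always_propagate (a : ℝ) {ε : ℝ} (hε : 0 < ε) (m : ℝ) (D : ℝ≥0∞) (h : Fin n → ℝ≥0∞)
    (T : List (Fin n)) : ∀ {r : SparseVec n}, r.Valid →
    (propagate G a ε m T r).Always fun r' k => r'.Valid ∧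
      (k : ℝ≥0∞) + r'.potential D h ≤ 1 + r.potential D h +
        (T.map fun v => 10 + D + ENNReal.ofReal (max ε (m / (G.degree v : ℝ) ^ a)) * h v).sum := by
  induction T with
  | nil => intro r hr; simp [propagate, hr]
  | cons v T ih =>
    intro r hr
    simp only [propagate, Comp.always_bind, Comp.always_step]
    refine (always_addTo D h hr v (lt_max_of_lt_left hε)).mono fun r' k ⟨hr', hk, hp⟩ => ?_
    refine (ih hr').mono fun r'' k' ⟨hr'', h''⟩ => ⟨hr'', ?_⟩
    have hk' : (k : ℝ≥0∞) ≤ 5 := by exact_mod_cast hk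
    simp only [List.map_cons, List.sum_cons]
    set S := (T.map fun v => 10 + D + ENNReal.ofReal (max ε (m / (G.degree v : ℝ) ^ a)) * h v).sum
    set W := ENNReal.ofReal (max ε (m / (G.degree v : ℝ) ^ a)) * h v
    push_cast
    calc _ = 5 + k + (k' + r''.potential D h) := by ring
      _ ≤ 5 + 5 + (1 + (r.potential D h + (D + W)) + S) :=
          add_le_add (by gcongr) (h''.trans (by gcongr))
      _ = _ := by ring

variable {G}

theorem prob_le {a ε m : ℝ} (v : Fin n) :
    prob G a (m / ε) v ≤ (m / (G.degree v : ℝ) ^ a) * (1 / ε) :=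
  (min_le_right _ _).trans (le_of_eq (by ring))

/-- Unbiasedness: either the probability is `1` and the exact amount is sent, or `ε` is sent with
probability amount over `ε`. -/
theorem prob_mul_max {a ε m : ℝ} (hε : 0 < ε) (v : Fin n) :
    prob G a (m / ε) v * max ε (m / (G.degree v : ℝ) ^ a) = m / (G.degree v : ℝ) ^ a := by
  have : m / ε / (G.degree v : ℝ) ^ a = m / (G.degree v : ℝ) ^ a / ε := by ring
  rw [prob, this]
  generalize m / (G.degree v : ℝ) ^ a = t
  rcases le_total ε t with h | h
  · rw [max_eq_right h, min_eq_left ((one_le_div hε).2 h), one_mul]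
  · rw [max_eq_left h, min_eq_right ((div_le_one hε).2 h), div_mul_cancel₀ _ hε.ne']

theorem propMatrix_apply (a b : ℝ) (v u : Fin n) :
    propMatrix G a b v u =
      if G.Adj v u then (G.degree v : ℝ) ^ (-a) * (G.degree u : ℝ) ^ (-b) else 0 := by
  rw [propMatrix, Matrix.mul_diagonal, Matrix.diagonal_mul, SimpleGraph.adjMatrix_apply]
  split <;> simp

theorem propMatrix_nonneg (a b : ℝ) (v u : Fin n) : 0 ≤ propMatrix G a b v u := by
  rw [propMatrix_apply]
  split <;> positivity

variable (G)

/-- The expected charge caused by one unit of residue at `u`, if each created position is charged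
`E * ε` and each unit of residue that arrives at `v` is charged `h v`. -/
noncomputable def pushCharge (a b κ : ℝ) (E : ℝ≥0∞) (h : Fin n → ℝ≥0∞) (u : Fin n) : ℝ≥0∞ :=
  ENNReal.ofReal κ * ∑ v, ENNReal.ofReal (propMatrix G a b v u) * (E + h v)

theorem sum_neighbours_eq_pushCharge {a b κ ρ : ℝ} (hκ : 0 ≤ κ) (hρ : 0 ≤ ρ) (E : ℝ≥0∞)
    (h : Fin n → ℝ≥0∞) (u : Fin n) :
    ∑ v ∈ G.neighborFinset u,
        ENNReal.ofReal (κ * ρ / (G.degree u : ℝ) ^ b / (G.degree v : ℝ) ^ a) * (E + h v) =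
      ENNReal.ofReal ρ * pushCharge G a b κ E h u := by
  rw [pushCharge, Finset.mul_sum, Finset.mul_sum, SimpleGraph.neighborFinset_eq_filter,
    Finset.sum_filter]
  refine Finset.sum_congr rfl fun v _ => ?_
  rw [propMatrix_apply]
  by_cases huv : G.Adj u v
  · rw [if_pos huv, if_pos huv.symm, ← mul_assoc, ← mul_assoc, ← ENNReal.ofReal_mul hρ,
      ← ENNReal.ofReal_mul (mul_nonneg hρ hκ), Real.rpow_neg (by positivity),
      Real.rpow_neg (by positivity)]
    congr 2
    ring
  · rw [if_neg huv, if_neg fun h => huv h.symm]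
    simp

theorem always_visit {a b ε κ σ : ℝ} (hε : 0 < ε) (u : Fin n) {mem : Memory n}
    (hv : mem.next.Valid) : (visit G a b ε κ σ u mem).Always fun mem' _ =>
      mem'.next.Valid ∧ mem'.cur = Function.update mem.cur u 0 := by
  simp only [visit, Comp.always_bind, Comp.always_step, Comp.always_pure]
  refine (Comp.always_true _).mono fun T t _ => ?_
  exact (always_propagate G a hε _ 0 0 T hv).mono fun r' k h => ⟨h.1, trivial⟩

/-- A sampled neighbour costs 54 for sampling, 10 for propagation and `D` for the new position,
whence `64 + D`, weighted by `p ≤ t / ε`. The charge `h` of arriving residue is weighted by `p * max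
ε t = t`, with no loss. -/
theorem expect_visit_le {a b ε κ σ : ℝ} (ha : 0 ≤ a) (ha1 : a ≤ 1) (hε : 0 < ε)
    (hκ : 0 ≤ κ) (D : ℝ≥0∞) (h : Fin n → ℝ≥0∞) (u : Fin n) {mem : Memory n}
    (hv : mem.next.Valid) (hu : 0 ≤ mem.cur u) :
    (visit G a b ε κ σ u mem).expect (fun mem' t => t + mem'.next.potential D h) ≤
      13 + 21 * (buckets G u).length + mem.next.potential D h +
        ENNReal.ofReal (mem.cur u) *
          pushCharge G a b κ ((64 + D) * ENNReal.ofReal (1 / ε)) h u := by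
  have hs : 0 ≤ κ * mem.cur u / (G.degree u : ℝ) ^ b / ε := by positivity
  simp only [visit, Comp.expect_bind, Comp.expect_step, Comp.expect_pure]
  rw [← sum_neighbours_eq_pushCharge G hκ hu]
  set m := κ * mem.cur u / (G.degree u : ℝ) ^ b with hm
  have hm0 : 0 ≤ m := by positivity
  set F : Fin n → ℝ≥0∞ :=
    fun v => 10 + D + ENNReal.ofReal (max ε (m / (G.degree v : ℝ) ^ a)) * h v with hF
  calc _ ≤ (sampleNeighbours G a (m / ε) u).expect
        (fun T t => (12 + mem.next.potential D h) + ((t : ℝ≥0∞) + (T.map F).sum)) := by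
        refine Comp.expect_mono fun T t => ?_
        refine (((always_propagate G a hε m D h T hv).mono fun r' k hk => ?_).expect_le).trans
            (Comp.expect_const _ _).le
        push_cast
        calc _ = 11 + (t : ℝ≥0∞) + (k + r'.potential D h) := by ring
          _ ≤ 11 + (t : ℝ≥0∞) + (1 + mem.next.potential D h + (T.map F).sum) :=
            add_le_add le_rfl hk.2
          _ = _ := by ring
    _ ≤ (12 + mem.next.potential D h) + ((1 + 21 * (buckets G u).length +
        54 * ∑ v ∈ G.neighborFinset u, ENNReal.ofReal (prob G a (m / ε) v)) +
        ∑ v ∈ G.neighborFinset u, ENNReal.ofReal (prob G a (m / ε) v) * F v) := by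
        rw [Comp.expect_add, Comp.expect_const, Comp.expect_add, expect_sampleNeighbours G ha hs]
        gcongr
        exact expect_time_sampleNeighbours G ha ha1 hs u
    _ = 13 + 21 * (buckets G u).length + mem.next.potential D h +
        ∑ v ∈ G.neighborFinset u, (54 * ENNReal.ofReal (prob G a (m / ε) v) +
          ENNReal.ofReal (prob G a (m / ε) v) * F v) := by
        rw [Finset.sum_add_distrib, Finset.mul_sum]
        ring
    _ ≤ _ := by
        gcongr with v hv
        have h1 : ENNReal.ofReal (prob G a (m / ε) v) ≤
            ENNReal.ofReal (m / (G.degree v : ℝ) ^ a) * ENNReal.ofReal (1 / ε) := by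
          rw [← ENNReal.ofReal_mul (by positivity)]
          exact ENNReal.ofReal_le_ofReal (prob_le v)
        have h2 : ENNReal.ofReal (prob G a (m / ε) v) *
            ENNReal.ofReal (max ε (m / (G.degree v : ℝ) ^ a)) =
            ENNReal.ofReal (m / (G.degree v : ℝ) ^ a) := by
          rw [← ENNReal.ofReal_mul (prob_nonneg hs v), prob_mul_max hε]
        calc _ = (64 + D) * ENNReal.ofReal (prob G a (m / ε) v) +
            ENNReal.ofReal (prob G a (m / ε) v) *
              ENNReal.ofReal (max ε (m / (G.degree v : ℝ) ^ a)) * h v := by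
              rw [hF]; ring
          _ ≤ (64 + D) * (ENNReal.ofReal (m / (G.degree v : ℝ) ^ a) * ENNReal.ofReal (1 / ε)) +
            ENNReal.ofReal (m / (G.degree v : ℝ) ^ a) * h v := by
              rw [h2]; gcongr
          _ = _ := by ring

theorem always_visitLoop {a b ε κ σ : ℝ} (hε : 0 < ε) (us : List (Fin n)) :
    ∀ {mem : Memory n}, mem.next.Valid →
    (visitLoop G a b ε κ σ us mem).Always fun mem' _ =>
      mem'.next.Valid ∧ mem'.cur = fun v => if v ∈ us then 0 else mem.cur v := by
  induction us with
  | nil => intro mem hv; simp [visitLoop, hv]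
  | cons u us ih =>
    intro mem hv
    simp only [visitLoop, Comp.always_bind, Comp.always_step]
    refine (always_visit G hε u hv).mono fun mem' _ ⟨h1, h2⟩ => ?_
    refine (ih h1).mono fun mem'' _ ⟨h3, h4⟩ => ⟨h3, ?_⟩
    rw [h4, h2]
    funext v
    by_cases h : v = u <;> simp [h]

/-- A visit clears only its own entry, so by `Nodup` the later visits still read the original
residues, and the bounds add. -/
theorem expect_visitLoop_le {a b ε κ σ : ℝ} (ha : 0 ≤ a) (ha1 : a ≤ 1) (hε : 0 < ε)
    (hκ : 0 ≤ κ) (D : ℝ≥0∞) (h : Fin n → ℝ≥0∞) (us : List (Fin n)) (hus : us.Nodup) :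
    ∀ {mem : Memory n}, mem.next.Valid → (∀ v, 0 ≤ mem.cur v) →
    (visitLoop G a b ε κ σ us mem).expect (fun mem' t => t + mem'.next.potential D h) ≤
      1 + mem.next.potential D h + (us.map fun u => 14 + 21 * ((buckets G u).length : ℝ≥0∞) +
        ENNReal.ofReal (mem.cur u) *
          pushCharge G a b κ ((64 + D) * ENNReal.ofReal (1 / ε)) h u).sum := by
  induction us with
  | nil => intro mem _ _; simp [visitLoop]
  | cons u us ih =>
    intro mem hv hc
    obtain ⟨hu, hus⟩ := List.nodup_cons.1 hus
    simp only [visitLoop, Comp.expect_bind, Comp.expect_step, List.map_cons, List.sum_cons]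
    set C := pushCharge G a b κ ((64 + D) * ENNReal.ofReal (1 / ε)) h
    set S := (us.map fun u => 14 + 21 * ((buckets G u).length : ℝ≥0∞) +
      ENNReal.ofReal (mem.cur u) * C u).sum
    calc _ ≤ (visit G a b ε κ σ u mem).expect
          (fun mem' t => (2 + S) + ((t : ℝ≥0∞) + mem'.next.potential D h)) := by
          refine ((always_visit G hε u hv).mono fun mem' t ⟨h1, h2⟩ => ?_).expect_le
          have hc' : ∀ v, 0 ≤ mem'.cur v := by
            intro v
            rw [h2]
            by_cases h : v = u
            · simp [h]
            · simpa [h] using hc v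
          have hS : (us.map fun u => 14 + 21 * ((buckets G u).length : ℝ≥0∞) +
              ENNReal.ofReal (mem'.cur u) * C u).sum = S := by
            refine congrArg List.sum (List.map_congr_left fun v hv => ?_)
            rw [h2, Function.update_of_ne (ne_of_mem_of_not_mem hv hu)]
          have := ih hus h1 hc'
          rw [hS] at this
          push_cast
          simp only [add_assoc, Comp.expect_add, Comp.expect_const] at this ⊢
          calc _ ≤ 1 + (t + (1 + (mem'.next.potential D h + S))) := by gcongr
            _ = _ := by ring
      _ ≤ (2 + S) + (13 + 21 * (buckets G u).length + mem.next.potential D h +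
          ENNReal.ofReal (mem.cur u) * C u) := by
          rw [Comp.expect_add, Comp.expect_const]
          gcongr
          exact expect_visit_le G ha ha1 hε hκ D h u hv (hc u)
      _ = _ := by ring

end AGP

namespace AGP

/-! ## The main loop -/

variable {n : ℕ}

/-! ### Tail sums of the weights -/

namespace Query

variable (q : Query n)

theorem summable_w_add (i : ℕ) : Summable fun k => q.w (i + k) := by
  simpa only [add_comm] using (summable_nat_add_iff i).2 q.w_hasSum.summable

theorem Y_nonneg (i : ℕ) : 0 ≤ q.Y i := tsum_nonneg fun _ => q.w_nonneg _

theorem Y_zero : q.Y 0 = 1 := by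
  simp only [Y, zero_add, q.w_hasSum.tsum_eq]

theorem Y_sub_w (i : ℕ) : q.Y i - q.w i = q.Y (i + 1) := by
  rw [Y, (q.summable_w_add i).tsum_eq_zero_add, Y, add_zero, add_sub_cancel_left]
  exact tsum_congr fun k => by rw [add_assoc, add_comm k 1]

/-- Minimality of the oracle's answer. It makes every division by `Y_i` inside the loop a genuine
one. -/
theorem Y_pos_of_lt_oracleL {Δ : ℝ} (hΔ : 0 < Δ) {i : ℕ} (hi : i < q.oracleL Δ) : 0 < q.Y i :=
  hΔ.trans (not_le.1 (Nat.notMem_of_lt_sInf hi))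

theorem card_pos (q : Query n) : 0 < n := by
  rcases Nat.eq_zero_or_pos n with rfl | h
  · simpa using q.x_sum
  · exact h

end Query

variable (G : SimpleGraph (Fin n)) [DecidableRel G.Adj]

/-- The expected charge that one unit of residue at a vertex causes in the iterations
`i, …, i + k - 1`, if each created position is charged `E * ε`. -/
noncomputable def loopCharge (q : Query n) (E : ℝ≥0∞) : (k i : ℕ) → Fin n → ℝ≥0∞
  | 0, _ => fun _ => 0
  | k + 1, i => pushCharge G q.a q.b (q.Y (i + 1) / q.Y i) E (loopCharge q E k (i + 1))

theorem mulVec_propMatrix_nonneg (a b : ℝ) {z : Fin n → ℝ} (hz : ∀ v, 0 ≤ z v) (v : Fin n) :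
    0 ≤ (propMatrix G a b).mulVec z v :=
  dotProduct_nonneg_of_nonneg (propMatrix_nonneg a b v) hz

/-- Adjointness: exchanging the sums moves the matrix from the charge to the vector. -/
theorem sum_mul_pushCharge (a b κ : ℝ) (E : ℝ≥0∞) (h : Fin n → ℝ≥0∞) {z : Fin n → ℝ}
    (hz : ∀ v, 0 ≤ z v) :
    ∑ u, ENNReal.ofReal (z u) * pushCharge G a b κ E h u =
      ENNReal.ofReal κ * ∑ v, ENNReal.ofReal ((propMatrix G a b).mulVec z v) * (E + h v) := by
  simp only [pushCharge, Finset.mul_sum]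
  rw [Finset.sum_comm]
  refine Finset.sum_congr rfl fun v _ => ?_
  rw [Matrix.mulVec, dotProduct, ENNReal.ofReal_sum_of_nonneg fun u _ =>
    mul_nonneg (propMatrix_nonneg a b v u) (hz u), Finset.sum_mul, Finset.mul_sum]
  refine Finset.sum_congr rfl fun u _ => ?_
  rw [ENNReal.ofReal_mul (propMatrix_nonneg a b v u)]
  ring

theorem l1_smul {c : ℝ} (hc : 0 ≤ c) {z : Fin n → ℝ} (hz : ∀ v, 0 ≤ z v) :
    ENNReal.ofReal (l1 (c • z)) = ENNReal.ofReal c * ∑ v, ENNReal.ofReal (z v) := by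
  rw [← ENNReal.ofReal_sum_of_nonneg fun v _ => hz v, ← ENNReal.ofReal_mul hc, Finset.mul_sum]
  simp only [l1, Pi.smul_apply, smul_eq_mul, abs_of_nonneg (mul_nonneg hc (hz _))]

/-- The prefactor `Y_i` cancels the denominator of `Y_{i+1} / Y_i` and becomes the prefactor
required by the induction hypothesis at `i + 1`, applied to the propagated vector. -/
theorem ofReal_Y_mul_sum_loopCharge (q : Query n) (E : ℝ≥0∞) (k : ℕ) :
    ∀ (i : ℕ) (z : Fin n → ℝ), (∀ v, 0 ≤ z v) → (∀ j < k, 0 < q.Y (i + j)) →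
    ENNReal.ofReal (q.Y i) * ∑ u, ENNReal.ofReal (z u) * loopCharge G q E k i u =
      E * ∑ j ∈ Finset.range k, ENNReal.ofReal
        (l1 (q.Y (i + (j + 1)) • (propMatrix G q.a q.b ^ (j + 1)).mulVec z)) := by
  induction k with
  | zero => intro i z _ _; simp [loopCharge]
  | succ k ih =>
    intro i z hz hY
    have hY0 : 0 < q.Y i := hY 0 (Nat.succ_pos k)
    have hPz := mulVec_propMatrix_nonneg G q.a q.b hz
    have hIH := ih (i + 1) _ hPz fun j hj => by
      rw [add_assoc, add_comm 1 j]; exact hY (j + 1) (by omega)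
    simp only [loopCharge]
    rw [sum_mul_pushCharge G _ _ _ _ _ hz, ← mul_assoc, ← ENNReal.ofReal_mul hY0.le,
      mul_div_cancel₀ _ hY0.ne', Finset.sum_range_succ']
    simp only [mul_add, Finset.sum_add_distrib]
    rw [hIH, zero_add, pow_one, l1_smul (q.Y_nonneg _) hPz, ← Finset.sum_mul]
    rw [add_comm]
    congr 1
    · congr 1
      refine Finset.sum_congr rfl fun j _ => ?_
      rw [Matrix.mulVec_mulVec, ← pow_succ]
      congr 4
      omega
    · ring

theorem always_addReserve (σ : ℝ) (r : Fin n → ℝ) (us : List (Fin n)) : ∀ out : Fin n → ℝ,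
    (addReserve σ r us out).Always fun _ t => t = 1 + 6 * us.length := by
  induction us with
  | nil => intro out; simp [addReserve]
  | cons u us ih =>
    intro out
    simp only [addReserve, Comp.always_bind, Comp.always_step]
    refine (ih _).mono fun _ t h => ?_
    simp only [List.length_cons]
    omega

/-- The number of buckets at the listed positions. -/
def openedBuckets (us : List (Fin n)) : ℕ := (us.map fun u => (buckets G u).length).sum

theorem openedBuckets_le (us : List (Fin n)) :
    openedBuckets G us ≤ us.length * (Nat.log 2 n + 1) := by
  have := List.sum_le_card_nsmul (us.map fun u => (buckets G u).length) (Nat.log 2 n + 1)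
    (by simpa using fun u _ => length_buckets_le G u)
  simpa [openedBuckets] using this

theorem sum_supp_le {us : List (Fin n)} (hus : us.Nodup) (f : Fin n → ℝ≥0∞) :
    (us.map f).sum ≤ ∑ u, f u := by
  rw [← List.sum_toFinset f hus]
  exact Finset.sum_le_univ_sum_of_nonneg fun _ => zero_le

/-- The charge of a position that is created during the main loop. -/
noncomputable def entryCharge (n : ℕ) : ℝ≥0∞ := 21 + 21 * ((Nat.log 2 n + 1 : ℕ) : ℝ≥0∞)

/-- Induction on the remaining iterations, for arbitrary `r`. The induction hypothesis for the next
residue is bounded by a constant plus its `potential`: list and bucket costs become `entryCharge n`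
per position, the rest is the charge `H`. The costs of the present list stay explicit, so that the
initial list can be paid by the initialization. -/
theorem expect_time_mainLoop_le (q : Query n) {ε : ℝ} (hε : 0 < ε) (k : ℕ) :
    ∀ (i : ℕ) (r : SparseVec n) (out : Fin n → ℝ), r.Valid → (∀ j < k, 0 < q.Y (i + j)) →
    (mainLoop G q ε k i (q.Y i) r 0 out).expect (fun _ t => (t : ℝ≥0∞)) ≤
      1 + (21 * (r.supp.length : ℝ≥0∞) + if k = 0 then 0 else 21 * (openedBuckets G r.supp : ℝ≥0∞)) +
        ∑ u, ENNReal.ofReal (r.val u) *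
          loopCharge G q ((64 + entryCharge n) * ENNReal.ofReal (1 / ε)) k i u := by
  induction k with
  | zero =>
    intro i r out hr _
    simp only [mainLoop, Comp.expect_bind, Comp.expect_step, loopCharge, mul_zero,
      Finset.sum_const_zero, add_zero, if_true]
    by_cases h : r.supp.isEmpty
    · simp [h]
    · have hl : 1 ≤ r.supp.length := by
        rw [Nat.one_le_iff_ne_zero, Ne, List.length_eq_zero_iff]
        simpa using h
      simp only [h, Bool.false_eq_true, if_false, Comp.expect_bind, Comp.expect_step]
      refine (((always_addReserve _ _ _ _).mono fun _ t ht => ?_).expect_le).trans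
        (Comp.expect_const _ _).le
      norm_cast
      omega
  | succ k ih =>
    intro i r out hr hY
    simp only [mainLoop, Comp.expect_bind, Comp.expect_step]
    by_cases h : r.supp.isEmpty
    · simp only [h, if_true, Comp.expect_pure]
      rw [add_assoc]
      simp
    · have hl : 1 ≤ r.supp.length := by
        rw [Nat.one_le_iff_ne_zero, Ne, List.length_eq_zero_iff]
        simpa using h
      simp only [h, Bool.false_eq_true, if_false, Comp.expect_bind, Comp.expect_step, q.Y_sub_w]
      set E := (64 + entryCharge n) * ENNReal.ofReal (1 / ε) with hE
      set H := loopCharge G q E k (i + 1)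
      have hκ : 0 ≤ q.Y (i + 1) / q.Y i := div_nonneg (q.Y_nonneg _) (q.Y_nonneg _)
      calc _ ≤ (visitLoop G q.a q.b ε (q.Y (i + 1) / q.Y i) (q.w i / q.Y i) r.supp
            ⟨r.val, ⟨0, []⟩, out⟩).expect
              (fun mem t => 7 + ((t : ℝ≥0∞) + mem.next.potential (entryCharge n) H)) := by
            refine ((always_visitLoop G hε _ SparseVec.valid_zero).mono
              fun mem t ⟨h1, h2⟩ => ?_).expect_le
            -- Every non-zero entry was visited and cleared, so the array can serve as the next
            -- blank one.
            have hcur : mem.cur = 0 := by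
              rw [h2]
              funext v
              have := hr.mem_supp v
              by_cases hv : v ∈ r.supp
              · simp [hv]
              · simpa [hv] using this
            have hIH := ih (i + 1) mem.next mem.out h1 fun j hj => by
              rw [add_assoc, add_comm 1 j]; exact hY (j + 1) (by omega)
            have hb : (if k = 0 then 0 else 21 * (openedBuckets G mem.next.supp : ℝ≥0∞)) ≤
                21 * (mem.next.supp.length * ((Nat.log 2 n + 1 : ℕ) : ℝ≥0∞)) := by
              split
              · exact zero_le
              · gcongr
                exact_mod_cast openedBuckets_le G mem.next.supp
            rw [hcur]
            push_cast
            simp only [Comp.expect_add, Comp.expect_const]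
            calc _ = 6 + (t : ℝ≥0∞) + (mainLoop G q ε k (i + 1) (q.Y (i + 1)) mem.next 0
                  mem.out).expect (fun _ t => (t : ℝ≥0∞)) := by ring
              _ ≤ 6 + (t : ℝ≥0∞) + (1 + (21 * (mem.next.supp.length : ℝ≥0∞) +
                  21 * (mem.next.supp.length * ((Nat.log 2 n + 1 : ℕ) : ℝ≥0∞))) +
                  ∑ u, ENNReal.ofReal (mem.next.val u) * H u) := by
                  refine add_le_add le_rfl (hIH.trans ?_)
                  gcongr
              _ = _ := by
                  rw [SparseVec.potential, entryCharge]
                  ring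
        _ ≤ 7 + (1 + 0 + (r.supp.map fun u => 14 + 21 * ((buckets G u).length : ℝ≥0∞) +
              ENNReal.ofReal (r.val u) * loopCharge G q E (k + 1) i u).sum) := by
            rw [Comp.expect_add, Comp.expect_const, ← SparseVec.potential_zero (entryCharge n) H]
            gcongr
            exact expect_visitLoop_le G q.a_nonneg q.a_le_one hε hκ _ H r.supp hr.nodup
              SparseVec.valid_zero hr.nonneg
        _ = 8 + (14 * (r.supp.length : ℝ≥0∞) + 21 * (openedBuckets G r.supp : ℝ≥0∞) +
              (r.supp.map fun u =>
                ENNReal.ofReal (r.val u) * loopCharge G q E (k + 1) i u).sum) := by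
            rw [List.sum_map_add, List.sum_map_add, list_sum_const_mul, openedBuckets,
              Nat.cast_list_sum, List.map_map]
            simp only [List.map_const', List.sum_replicate, nsmul_eq_mul, Function.comp_def]
            ring
        _ ≤ 8 + (14 * (r.supp.length : ℝ≥0∞) + 21 * (openedBuckets G r.supp : ℝ≥0∞) +
              ∑ u, ENNReal.ofReal (r.val u) * loopCharge G q E (k + 1) i u) := by
            gcongr
            exact sum_supp_le hr.nodup _
        _ ≤ _ := by
            -- The list is non-empty here, so 7 instructions of overhead are charged to it; this is
            -- why each position pays 21 rather than 14.
            have h8 : 8 + 14 * (r.supp.length : ℝ≥0∞) ≤ 1 + 21 * r.supp.length := by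
              norm_cast
              omega
            rw [if_neg (Nat.succ_ne_zero k)]
            simpa only [add_assoc] using add_le_add h8 le_rfl

/-! ## The whole query -/

/-- For `n ≤ 1` the logarithm gives no room, but then there are no edges and nothing is propagated.
-/
theorem propMatrix_eq_zero_of_le_one (hn : n ≤ 1) (a b : ℝ) : propMatrix G a b = 0 := by
  have : Subsingleton (Fin n) := Fin.subsingleton_iff_le_one.2 hn
  ext v u
  rw [propMatrix_apply, if_neg fun h => h.ne (Subsingleton.elim v u), Matrix.zero_apply]

theorem entryCharge_le (hn : 2 ≤ n) : 64 + entryCharge n ≤ ENNReal.ofReal (265 * Real.log n) := by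
  have h := log_two_add_two_le hn
  calc 64 + entryCharge n = ENNReal.ofReal (106 + 21 * Nat.log 2 n) := by
        rw [ENNReal.ofReal_add (by norm_num) (by positivity), ENNReal.ofReal_mul (by norm_num)]
        simp only [ENNReal.ofReal_ofNat, ENNReal.ofReal_natCast, entryCharge]
        push_cast
        ring
    -- `106 + 21 ℓ ≤ 53 (ℓ + 2) ≤ 265 log n`.
    _ ≤ _ := ENNReal.ofReal_le_ofReal (by nlinarith [Nat.cast_nonneg (α := ℝ) (Nat.log 2 n)])

theorem charge_le (q : Query n) {δ c : ℝ} (hδ : 0 < δ) (hc : 0 < c) (L : ℕ) :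
    (64 + entryCharge n) * ENNReal.ofReal (1 / (c * c * δ / (2 * ((L + 1 : ℕ) : ℝ)))) *
        ∑ j ∈ Finset.range L, ENNReal.ofReal
          (l1 (q.Y (j + 1) • (propMatrix G q.a q.b ^ (j + 1)).mulVec q.x)) ≤
      ENNReal.ofReal (1060 / c ^ 2) * ENNReal.ofReal (Real.log n * ((L : ℝ) / δ) *
        ∑ i ∈ Finset.Icc 1 L, l1 (q.Y i • (propMatrix G q.a q.b ^ i).mulVec q.x)) := by
  rcases Nat.lt_or_ge n 2 with hn | hn
  · rw [Finset.sum_eq_zero, mul_zero]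
    · exact zero_le
    · intro j _
      rw [propMatrix_eq_zero_of_le_one G (by omega)]
      simp [l1]
  rcases Nat.eq_zero_or_pos L with rfl | hL
  · simp
  have hsum : ∑ i ∈ Finset.Icc 1 L, l1 (q.Y i • (propMatrix G q.a q.b ^ i).mulVec q.x) =
      ∑ j ∈ Finset.range L, l1 (q.Y (j + 1) • (propMatrix G q.a q.b ^ (j + 1)).mulVec q.x) := by
    rw [Finset.range_eq_Ico, Finset.sum_Ico_add'
      (fun i => l1 (q.Y i • (propMatrix G q.a q.b ^ i).mulVec q.x))]
    rfl
  have hl1 : ∀ z : Fin n → ℝ, 0 ≤ l1 z := fun z => Finset.sum_nonneg fun _ _ => abs_nonneg _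
  rw [hsum, ← ENNReal.ofReal_sum_of_nonneg fun _ _ => hl1 _]
  set S := ∑ j ∈ Finset.range L, l1 (q.Y (j + 1) • (propMatrix G q.a q.b ^ (j + 1)).mulVec q.x)
  have hS : 0 ≤ S := Finset.sum_nonneg fun _ _ => hl1 _
  have hlog : 0 ≤ Real.log n := Real.log_natCast_nonneg n
  have hL1 : (1 : ℝ) ≤ L := by exact_mod_cast hL
  -- `2 (L + 1) ≤ 4 L` as `L ≥ 1`; with 265 this produces 1060.
  have hε : 1 / (c * c * δ / (2 * ((L + 1 : ℕ) : ℝ))) ≤ 4 / c ^ 2 * (L / δ) := by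
    push_cast
    rw [one_div_div, div_mul_div_comm, ← sq]
    exact div_le_div_of_nonneg_right (by linarith) (by positivity)
  calc _ ≤ ENNReal.ofReal (265 * Real.log n) * ENNReal.ofReal (4 / c ^ 2 * (L / δ)) *
        ENNReal.ofReal S := by
        gcongr
        exact entryCharge_le hn
    _ = _ := by
        rw [← ENNReal.ofReal_mul (by positivity), ← ENNReal.ofReal_mul (by positivity),
          ← ENNReal.ofReal_mul (by positivity)]
        congr 1
        ring

theorem expectedTime_agpStaticPP_le (q : Query n) {δ c : ℝ} (hδ : 0 < δ) (hc : 0 < c)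
    {load : Comp (SparseVec n)} (hload : IsInitialization load q.x) :
    (agpStaticPP G q δ c load).expectedTime ≤
      22 * expectedInitCost G q δ c load +
      ENNReal.ofReal (1060 / c ^ 2) * ENNReal.ofReal
        (Real.log n * ((q.oracleL (c * δ) : ℝ) / δ) * ∑ i ∈ Finset.Icc 1 (q.oracleL (c * δ)),
          l1 (q.Y i • (propMatrix G q.a q.b ^ i).mulVec q.x)) := by
  refine le_trans ?_ (add_le_add le_rfl (charge_le G q hδ hc (q.oracleL (c * δ))))
  simp only [Comp.expectedTime, agpStaticPP, initPhase, expectedInitCost, Comp.expect_bind,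
    Comp.expect_step, Comp.expect_pure]
  have hY : ∀ i < q.oracleL (c * δ), 0 < q.Y i :=
    fun _ => q.Y_pos_of_lt_oracleL (mul_pos hc hδ)
  set L := q.oracleL (c * δ)
  set ε := c * c * δ / (2 * ((L + 1 : ℕ) : ℝ))
  have hε : 0 < ε := by positivity
  set E := (64 + entryCharge n) * ENNReal.ofReal (1 / ε)
  have hcharge := ofReal_Y_mul_sum_loopCharge G q E L 0 q.x q.x_nonneg
    fun j hj => hY _ (by simpa using hj)
  simp only [q.Y_zero, ENNReal.ofReal_one, one_mul, zero_add] at hcharge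
  rw [← hcharge]
  -- Linearity in the residue lets a random unbiased start replace `x`; what remains is an
  -- inequality for each outcome of `load`.
  have hunb : ∑ u, ENNReal.ofReal (q.x u) * loopCharge G q E L 0 u =
      load.expect fun r _ => ∑ u, ENNReal.ofReal (r.val u) * loopCharge G q E L 0 u := by
    rw [Comp.expect_finset_sum]
    refine Finset.sum_congr rfl fun u _ => ?_
    simp only [mul_comm _ (loopCharge G q E L 0 u), Comp.expect_const_mul, hload.unbiased]
  rw [hunb, ← Comp.expect_const_mul, ← Comp.expect_add]
  refine Comp.Always.expect_le fun z hz => ?_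
  have hmain := expect_time_mainLoop_le G q hε L 0 z.1 0
    ⟨hload.nonneg z hz, hload.nodup z hz, hload.mem_supp z hz⟩
    fun j hj => hY _ (by simpa using hj)
  rw [q.Y_zero] at hmain
  have hlen : (z.1.supp.length : ℝ≥0∞) ≤ z.2 := by exact_mod_cast hload.length_le z hz
  change _ ≤ 22 * (_ + if L = 0 then 0 else (openedBuckets G z.1.supp : ℝ≥0∞)) + _
  push_cast
  simp only [Comp.expect_add, Comp.expect_const]
  refine (add_le_add le_rfl hmain).trans ?_
  rw [← add_assoc]
  gcongr
  -- Loading in `t` steps lists at most `t` positions, so the total is at most `8 + 22 t + 21 b`,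
  -- where `b` is the number of opened buckets (absent if `L = 0`).
  split
  · calc _ ≤ 1 + (1 + (1 + (1 + (1 + (1 + (1 + ((z.2 : ℝ≥0∞) + 0))))))) +
          (1 + (21 * (z.2 : ℝ≥0∞) + 0)) := by gcongr
      _ ≤ _ := by norm_cast; omega
  · calc _ ≤ 1 + (1 + (1 + (1 + (1 + (1 + (1 + ((z.2 : ℝ≥0∞) + 0))))))) +
          (1 + (21 * (z.2 : ℝ≥0∞) + 21 * (openedBuckets G z.1.supp : ℝ≥0∞))) := by gcongr
      _ ≤ _ := by norm_cast; omega

/-! ## The deterministic initialization -/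

theorem always_readLoop (x : Fin n → ℝ) (hx : ∀ v, 0 ≤ x v) (vs : List (Fin n)) :
    vs.Nodup → ∀ {r : SparseVec n}, r.Valid → (∀ v ∈ vs, r.val v = 0) →
    (readLoop x vs r).Always fun r' t => r'.Valid ∧
      (∀ v, r'.val v = if v ∈ vs then x v else r.val v) ∧
      r'.supp.length ≤ r.supp.length + t ∧ t ≤ 1 + 5 * vs.length := by
  induction vs with
  | nil => intro _ r hr _; simp [readLoop, hr]
  | cons v vs ih =>
    intro hvs r hr h0
    obtain ⟨hv, hvs⟩ := List.nodup_cons.1 hvs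
    simp only [readLoop, Comp.always_bind, Comp.always_step]
    by_cases hxv : x v = 0
    · simp only [hxv, decide_true, if_true]
      refine (ih hvs hr fun w hw => h0 w (by simp [hw])).mono fun r' t ⟨h1, h2, h3, h4⟩ =>
        ⟨h1, fun w => ?_, by omega, by simp only [List.length_cons]; omega⟩
      rw [h2]
      rcases eq_or_ne w v with rfl | hw
      · simp [hv, hxv, h0 w (by simp)]
      · simp [hw]
    · simp only [hxv, decide_false, Bool.false_eq_true, if_false, Comp.always_bind,
        Comp.always_step]
      have hr' : (⟨Function.update r.val v (x v), v :: r.supp⟩ : SparseVec n).Valid := by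
        refine ⟨fun w => ?_, List.nodup_cons.2 ⟨fun h => (hr.mem_supp v).1 h (h0 v (by simp)),
          hr.nodup⟩, fun w => ?_⟩ <;> rcases eq_or_ne w v with rfl | hw
        · simpa using hx w
        · simpa [hw] using hr.nonneg w
        · simpa using hxv
        · simpa [hw] using hr.mem_supp w
      refine (ih hvs hr' fun w hw => ?_).mono fun r' t ⟨h1, h2, h3, h4⟩ =>
        ⟨h1, fun w => ?_, ?_, by simp only [List.length_cons]; omega⟩
      · simp only [Function.update_of_ne (ne_of_mem_of_not_mem hw hv)]
        exact h0 w (by simp [hw])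
      · rw [h2]
        rcases eq_or_ne w v with rfl | hw
        · simp [hv]
        · simp [hw]
      · simp only [List.length_cons] at h3
        omega

theorem always_readInput {x : Fin n → ℝ} (hx : ∀ v, 0 ≤ x v) :
    (readInput x).Always fun r t => r.Valid ∧ (∀ v, r.val v = x v) ∧
      r.supp.length ≤ t ∧ t ≤ 1 + 5 * n := by
  refine (always_readLoop x hx _ (List.nodup_finRange n) SparseVec.valid_zero
    fun _ _ => rfl).mono fun r t ⟨h1, h2, h3, h4⟩ => ⟨h1, ?_, ?_, ?_⟩
  · simpa using h2
  · simpa using h3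
  · simpa using h4

theorem isInitialization_readInput {x : Fin n → ℝ} (hx : ∀ v, 0 ≤ x v) :
    IsInitialization (readInput x) x where
  nonneg z hz := (always_readInput hx z hz).1.nonneg
  nodup z hz := (always_readInput hx z hz).1.nodup
  mem_supp z hz := (always_readInput hx z hz).1.mem_supp
  length_le z hz := (always_readInput hx z hz).2.2.1
  unbiased v := by
    rw [((always_readInput hx).mono fun r t h => congrArg ENNReal.ofReal (h.2.1 v)).expect_congr,
      Comp.expect_const]

theorem expectedInitCost_readInput_le (q : Query n) (δ c : ℝ) :
    expectedInitCost G q δ c (readInput q.x) ≤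
      13 * (n + ((∑ u with q.x u ≠ 0, (buckets G u).length : ℕ) : ℝ≥0∞)) := by
  simp only [expectedInitCost, initPhase, Comp.expect_bind, Comp.expect_step, Comp.expect_pure]
  refine (((always_readInput q.x_nonneg).mono fun r t ⟨h1, h2, _, h4⟩ => ?_).expect_le).trans
    (Comp.expect_const _ _).le
  have hsum : (r.supp.map fun u => (buckets G u).length).sum =
      ∑ u with q.x u ≠ 0, (buckets G u).length := by
    rw [← List.sum_toFinset _ h1.nodup]
    refine Finset.sum_congr ?_ fun _ _ => rfl
    ext u
    simp [h1.mem_supp, h2]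
  rw [hsum]
  -- `‖x‖₁ = 1` excludes `n = 0`, so `7 + (1 + 5 n) ≤ 13 n`.
  have hn := q.card_pos
  split
  · rw [add_zero]
    norm_cast
    omega
  · norm_cast
    omega

end AGP

/-! ### Assembly of the three statements -/

theorem mainTheorem4 :
    (∃ K : ℝ≥0, ∀ (n : ℕ), 2 ≤ n → ∀ (G : SimpleGraph (Fin n)) [DecidableRel G.Adj]
        (u : Fin n) (a s : ℝ), 0 ≤ a → a ≤ 1 → 0 ≤ s →
        (AGP.sampleNeighbours G a s u).expect (fun T _ => (T.length : ℝ≥0∞)) =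
            ENNReal.ofReal (AGP.meanSize G a s u) ∧
          (AGP.sampleNeighbours G a s u).expectedTime ≤
            K * ENNReal.ofReal (AGP.meanSize G a s u + Real.log n)) ∧
    (∀ c : ℝ, 0 < c → ∃ K : ℝ≥0, ∀ (n : ℕ) (G : SimpleGraph (Fin n)) [DecidableRel G.Adj]
        (q : AGP.Query n) (δ : ℝ), 0 < δ →
        ∀ load : AGP.Comp (AGP.SparseVec n), AGP.IsInitialization load q.x →
          (AGP.agpStaticPP G q δ c load).expectedTime ≤
            K * (ENNReal.ofReal (Real.log n * ((q.oracleL (c * δ) : ℝ) / δ) *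
                  ∑ i ∈ Finset.Icc 1 (q.oracleL (c * δ)),
                    AGP.l1 (q.Y i • ((AGP.propMatrix G q.a q.b ^ i).mulVec q.x)))
                + AGP.expectedInitCost G q δ c load)) ∧
    (∃ K : ℝ≥0, ∀ (n : ℕ) (G : SimpleGraph (Fin n)) [DecidableRel G.Adj]
        (q : AGP.Query n) (δ c : ℝ), 0 < δ → 0 < c →
        AGP.IsInitialization (AGP.readInput q.x) q.x ∧
          AGP.expectedInitCost G q δ c (AGP.readInput q.x) ≤
            K * (n + ((∑ u with q.x u ≠ 0, (AGP.buckets G u).length : ℕ) : ℝ≥0∞))) := by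
  refine ⟨⟨105, ?_⟩, ?_, ⟨13, ?_⟩⟩
  · intro n hn G _ u a s ha ha1 hs
    refine ⟨?_, by simpa using AGP.expectedTime_sampleNeighbours_le G hn ha ha1 hs u⟩
    have h := AGP.expect_sampleNeighbours G ha hs (fun _ => 1) u
    simpa [AGP.ofReal_meanSize G hs] using h
  · intro c hc
    refine ⟨22 + Real.toNNReal (1060 / c ^ 2), ?_⟩
    intro n G _ q δ hδ load hload
    refine (AGP.expectedTime_agpStaticPP_le G q hδ hc hload).trans ?_
    rw [add_comm, mul_add, ENNReal.coe_add, ENNReal.coe_ofNat]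
    gcongr
    · exact le_add_self
    · exact le_self_add
  · intro n G _ q δ c _ _
    exact ⟨AGP.isInitialization_readInput q.x_nonneg,
      by simpa using AGP.expectedInitCost_readInput_le G q δ c⟩
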